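/- Let $n\ge 2$ and $\alpha\in(0,1)$. Let $\operatorname{dist}_{\mathbb S^n}(x,z)=\arccos\langle x,z\rangle$ be the spherical distance on the unit sphere $\mathbb S^n\subset\mathbb R^{n+1}$, let $\omega_n=|\mathbb S^n|$, let $\mathbf e_{n+1}=(0,\dots,0,1)$, and set $$\gamma_{n,\alpha}=\frac{\omega_n}{n(n+1)}\Big[\int_{\mathbb R^{n+1}}|y-\mathbf e_{n+1}|^{-n-1}\,|y|^{-1}\operatorname{dist}_{\mathbb S^n}\big(y/|y|,\mathbf e_{n+1}\big)^{\alpha}\,dy\Big]^{-1}.$$ Let $f\in C^\alpha(\mathbb S^n)$ be a positive function such that $$|f|_{C^\alpha(\mathbb S^n)}\le\gamma_{n,\alpha}\min_{\mathbb S^n}f,\qquad\text{where}\quad |f|_{C^\alpha(\mathbb S^n)}=\sup_{x\ne z}\frac{|f(x)-f(z)|}{\operatorname{dist}_{\mathbb S^n}(x,z)^\alpha}.$$ Then every solution $u\in C^2(\mathbb S^n)$ of the Christoffel equation $$\Delta_{\mathbb S^n}u+nu=f\quad\text{on }\mathbb S^n$$ is convex: the matrix $\nabla^2u+uI$ is positive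 semidefinite at every point of $\mathbb S^n$, where $\nabla$ denotes covariant differentiation on $\mathbb S^n$, and the extension of $u$ to $\mathbb R^{n+1}$ that is homogeneous of degree $1$ is a convex function on $\mathbb R^{n+1}$. -/

import Mathlib

open scoped Manifold ContDiff Laplacian RealInnerProductSpace

noncomputable section

namespace ChristoffelProblem

/-- The Euclidean space `ℝ^{n+1}`. -/
abbrev Space (n : ℕ) : Type := EuclideanSpace ℝ (Fin (n + 1))

/-- The unit sphere `𝕊^n` in `ℝ^{n+1}`. -/
abbrev Sph (n : ℕ) : Type := Metric.sphere (0 : Space n) 1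

theorem normalize_mem {n : ℕ} {y : Space n} (hy : y ≠ 0) :
    ‖y‖⁻¹ • y ∈ Metric.sphere (0 : Space n) 1 := by
  simp [norm_smul, norm_ne_zero_iff.mpr hy]

/-- The extension of a function on `𝕊^n` to `ℝ^{n+1}` that is homogeneous of degree `k`:
`y ↦ |y|^k u(y/|y|)` for `y ≠ 0` (and `0` at the origin). -/
def homExt {n : ℕ} (k : ℕ) (u : Sph n → ℝ) (y : Space n) : ℝ :=
  open Classical in
  if hy : y = 0 then 0 else ‖y‖ ^ k * u ⟨‖y‖⁻¹ • y, normalize_mem hy⟩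

/-- The Laplace–Beltrami operator `Δ_{𝕊^n}`: the Euclidean Laplacian, at points of the sphere,
of the extension of `u` that is constant along rays. -/
def laplaceBeltrami {n : ℕ} (u : Sph n → ℝ) (x : Sph n) : ℝ :=
  (Δ (homExt 0 u)) (x : Space n)

/-- The covariant Hessian `∇²u` of a function on `𝕊^n`, as a bilinear form on the tangent space
`{ξ | ⟪x, ξ⟫ = 0}` at `x`. For tangent vectors it is the Euclidean second derivative of the
extension of `u` that is constant along rays (the radial derivative of which vanishes, so that the
normal component of the acceleration of curves on the sphere does not contribute). -/
def covHessian {n : ℕ} (u : Sph n → ℝ) (x : Sph n) (ξ η : Space n) : ℝ :=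
  iteratedFDeriv ℝ 2 (homExt 0 u) (x : Space n) ![ξ, η]

/-- `u` is a (classical, `C²`) solution of `Δ_{𝕊^n} u + n u = f` on `𝕊^n`. -/
structure IsSolution {n : ℕ} (f u : Sph n → ℝ) : Prop where
  contMDiff : ContMDiff (𝓡 n) 𝓘(ℝ, ℝ) 2 u
  equation : ∀ x : Sph n, laplaceBeltrami u x + n * u x = f x

/-- The matrix `∇²u + u I` is positive semidefinite on every tangent space of `𝕊^n`. -/
def HessianNonneg {n : ℕ} (u : Sph n → ℝ) : Prop :=
  ∀ (x : Sph n) (ξ : Space n), ⟪(x : Space n), ξ⟫ = 0 →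
    0 ≤ covHessian u x ξ ξ + u x * ⟪ξ, ξ⟫

/-- The spherical (geodesic) distance on `𝕊^n`, `arccos ⟪x, z⟫`. -/
def sphDist {n : ℕ} (x z : Sph n) : ℝ :=
  InnerProductGeometry.angle (x : Space n) (z : Space n)

/-- `f ∈ C^α(𝕊^n)`. -/
def IsHolder {n : ℕ} (α : ℝ) (f : Sph n → ℝ) : Prop :=
  ∃ C : ℝ, ∀ x z : Sph n, |f x - f z| ≤ C * sphDist x z ^ α

/-- The Hölder seminorm `sup_{x ≠ z} |f(x) - f(z)| / dist_{𝕊^n}(x, z)^α`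
(the terms with `x = z` are `0 / 0 = 0`). -/
def holderSeminorm {n : ℕ} (α : ℝ) (f : Sph n → ℝ) : ℝ :=
  ⨆ p : Sph n × Sph n, |f p.1 - f p.2| / sphDist p.1 p.2 ^ α

/-- `ω_n = |𝕊^n|`, the surface area of the unit sphere of `ℝ^{n+1}`. -/
def omega (n : ℕ) : ℝ :=
  (MeasureTheory.volume : MeasureTheory.Measure (Space n)).toSphere.real Set.univ

/-- The point `e_{n+1} = (0, …, 0, 1)`. -/
def northPole (n : ℕ) : Space n := EuclideanSpace.single (Fin.last n) 1

/-- The constant `γ_{n,α} = ω_n / (n (n + 1)) *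
[∫_{ℝ^{n+1}} |y - e_{n+1}|^{-n-1} |y|^{-1} dist_{𝕊^n}(y/|y|, e_{n+1})^α dy]⁻¹`. -/
def gammaConst (n : ℕ) (α : ℝ) : ℝ :=
  omega n / (n * (n + 1)) *
    (∫ y : Space n, (‖y - northPole n‖ ^ (n + 1))⁻¹ * ‖y‖⁻¹ *
      InnerProductGeometry.angle (‖y‖⁻¹ • y) (northPole n) ^ α)⁻¹

end ChristoffelProblem

end

noncomputable section

namespace ChristoffelProblem

open MeasureTheory Set Filter Topology

/-! ### Directional integration by parts on the whole space. -/

section IntegrationByParts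

variable {E : Type*} [NormedAddCommGroup E] [InnerProductSpace ℝ E]

/-! Let `U = homExt 1 u` and `m = n + 1`. The Christoffel equation says that the Euclidean Laplacian
of `U` is `|y|⁻¹ f(y/|y|)`, and on the tangent space at `x` the Hessian of `U` is `∇²u + uI`. So the
Hessian is a singular integral of `f` against second derivatives of the Newton potential, whose size
is at most `(m - 1)|y - x|^{-m} / ω_n`. This is not integrable at `x`, but constants can be
subtracted: `u - f(x)/n` solves the equation with right-hand side `f - f(x)`, and the Hölder bound
then controls the integrand. For a unit tangent vector `ξ` this gives `|(∇²u + uI)(ξ,ξ) - f(x)/n| ≤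
(n/ω_n) |f|_{C^α} ∫ |y - x|^{-n-1} |y|⁻¹ dist(y/|y|, x)^α dy`. By rotation invariance the integral
is the one in `γ_{n,α}`, so the right side is at most `f(x)/(n+1) < f(x)/n`, and the Hessian is
nonnegative.

No representation formula for `U` is needed. The potential is regularized by replacing `|z|` with
`(1 + |z|²)^{1/2}`; its Laplacian is then `ρ = m(1 + |z|²)^{-(m+2)/2}`, an approximate identity of
mass `ω_n` after rescaling by `ε`. Testing `U(x + εz)` against `∂_ξξ ρ` recovers `D²U(x)(ξ,ξ)` as `ε
→ 0` (`tendsto_integral_mul_kernelLaplacian`). Green's identity (`integral_mul_kernelLaplacian`)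
turns the same integral into one of `ΔU` against `kernel`, bounded uniformly in `ε`
(`abs_second_deriv_mul_le`). The estimate at `x` is `IsSolution.abs_hessian_mul_omega_le`, the
pinching argument is `IsSolution.hessianNonneg`.

Convexity of `U` follows because `U` dominates each of its tangent linear functionals, with equality
at the point of tangency (`HessianNonneg.fderiv_homExt_one_le`). -/

theorem hasDerivAt_inner_line (z v ξ : E) :
    HasDerivAt (fun τ : ℝ => ⟪z + τ • v, ξ⟫) ⟪v, ξ⟫ 0 := by
  have h : (fun τ : ℝ => ⟪z + τ • v, ξ⟫) = fun τ => ⟪z, ξ⟫ + τ * ⟪v, ξ⟫ := by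
    ext τ; rw [inner_add_left, real_inner_smul_left]
  rw [h]
  simpa using ((hasDerivAt_id (0 : ℝ)).mul_const ⟪v, ξ⟫).const_add ⟪z, ξ⟫

theorem hasDerivAt_norm_sq_line (z v : E) :
    HasDerivAt (fun τ : ℝ => ‖z + τ • v‖ ^ 2) (2 * ⟪z, v⟫) 0 := by
  have h : (fun τ : ℝ => ‖z + τ • v‖ ^ 2) =
      fun τ => ‖z‖ ^ 2 + τ * (2 * ⟪z, v⟫) + τ ^ 2 * ‖v‖ ^ 2 := by
    ext τ
    rw [norm_add_sq_real, real_inner_smul_right, norm_smul, Real.norm_eq_abs, mul_pow, sq_abs]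
    ring
  rw [h]
  have h1 := (((hasDerivAt_id (0 : ℝ)).mul_const (2 * ⟪z, v⟫)).const_add (‖z‖ ^ 2)).add
    ((hasDerivAt_pow 2 (0 : ℝ)).mul_const (‖v‖ ^ 2))
  convert! h1 using 1
  simp

variable [FiniteDimensional ℝ E] [MeasurableSpace E] [BorelSpace E]

/-- The integral of a directional derivative vanishes as soon as it converges and the function
itself is integrable against `(1 + ‖x‖)⁻¹`. -/
theorem integral_lineDeriv_eq_zero {v : E} {h h' : E → ℝ}
    (hd : ∀ x, HasLineDerivAt ℝ h (h' x) x v) (hi' : Integrable h')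
    (hi : Integrable fun x => h x * (1 + ‖x‖)⁻¹) : ∫ x, h' x = 0 := by
  let δ : ℕ → ℝ := fun k => 1 / ((k : ℝ) + 1)
  have hδ0 : ∀ k, 0 < δ k := fun k => by positivity
  have hδ1 : ∀ k, δ k ≤ 1 := fun k => by
    simp only [δ]; rw [div_le_one (by positivity)]; linarith [(Nat.cast_nonneg k : (0 : ℝ) ≤ k)]
  have hδt : Tendsto δ atTop (𝓝 0) := tendsto_one_div_add_atTop_nhds_zero_nat
  -- Rational cutoffs: they increase to 1 as `δ k → 0`, while their derivatives tend to 0 and are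
  -- `O((1 + ‖x‖)⁻¹)` uniformly in `k`. The weighted integrability of `h` therefore provides the
  -- dominating function.
  let χ : ℕ → E → ℝ := fun k x => (1 + δ k * ‖x‖ ^ 2)⁻¹
  let χ' : ℕ → E → ℝ := fun k x => -(δ k * (2 * ⟪x, v⟫)) / (1 + δ k * ‖x‖ ^ 2) ^ 2
  have hpos : ∀ k (x : E), 0 < 1 + δ k * ‖x‖ ^ 2 := fun k x => by have := hδ0 k; positivity
  have hχd : ∀ k x, HasLineDerivAt ℝ (χ k) (χ' k x) x v := by
    intro k x
    have h1 := ((hasDerivAt_norm_sq_line x v).const_mul (δ k)).const_add 1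
    have h2 := h1.inv (by simpa using (hpos k x).ne')
    simp only [zero_smul, add_zero] at h2
    exact h2
  have hχc : ∀ k, Continuous (χ k) := fun k => by
    refine Continuous.inv₀ (by fun_prop) (fun x => (hpos k x).ne')
  have hχ'c : ∀ k, Continuous (χ' k) := fun k => by
    refine Continuous.div (by fun_prop) (by fun_prop) (fun x => (pow_pos (hpos k x) 2).ne')
  have hχb : ∀ k x, |χ k x| ≤ 1 := fun k x => by
    simp only [χ]
    rw [abs_of_pos (inv_pos.2 (hpos k x))]
    apply inv_le_one_of_one_le₀
    have := hδ0 k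
    nlinarith [sq_nonneg ‖x‖]
  have hχ'b : ∀ k x, |χ' k x| ≤ 4 * ‖v‖ * (1 + ‖x‖)⁻¹ := fun k x => by
    simp only [χ']
    have hp := hpos k x
    have h0 := (hδ0 k).le
    have hx : |⟪x, v⟫| ≤ ‖x‖ * ‖v‖ := abs_real_inner_le_norm x v
    rw [abs_div, abs_neg, abs_mul, abs_mul, abs_of_pos (hδ0 k), abs_of_pos (pow_pos hp 2),
      abs_two, ← div_eq_mul_inv, div_le_div_iff₀ (pow_pos hp 2) (by positivity)]
    have hA : δ k * (‖x‖ * (1 + ‖x‖)) ≤ 2 * (1 + δ k * ‖x‖ ^ 2) := by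
      have : ‖x‖ ≤ 1 + ‖x‖ ^ 2 := by nlinarith [sq_nonneg (‖x‖ - 1)]
      nlinarith [mul_le_mul_of_nonneg_left this h0, hδ1 k]
    have hB : 1 + δ k * ‖x‖ ^ 2 ≤ (1 + δ k * ‖x‖ ^ 2) ^ 2 := by
      nlinarith [mul_nonneg h0 (sq_nonneg ‖x‖)]
    calc δ k * (2 * |⟪x, v⟫|) * (1 + ‖x‖) ≤ δ k * (2 * (‖x‖ * ‖v‖)) * (1 + ‖x‖) := by gcongr
      _ = 2 * ‖v‖ * (δ k * (‖x‖ * (1 + ‖x‖))) := by ring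
      _ ≤ 2 * ‖v‖ * (2 * (1 + δ k * ‖x‖ ^ 2)) := by gcongr
      _ ≤ 2 * ‖v‖ * (2 * (1 + δ k * ‖x‖ ^ 2) ^ 2) := by gcongr
      _ = _ := by ring
  have hm : AEStronglyMeasurable h := by
    have : h = fun x => (h x * (1 + ‖x‖)⁻¹) * (1 + ‖x‖) := by
      ext x
      have : 1 + ‖x‖ ≠ 0 := by positivity
      field_simp
    rw [this]
    exact hi.1.mul (by fun_prop : Continuous fun x : E => 1 + ‖x‖).aestronglyMeasurable
  have hb1 : ∀ k, ∀ᵐ x, ‖h' x * χ k x‖ ≤ |h' x| := fun k => ae_of_all _ fun x => by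
    rw [Real.norm_eq_abs, abs_mul]
    exact mul_le_of_le_one_right (abs_nonneg _) (hχb k x)
  have hb2 : ∀ k, ∀ᵐ x, ‖h x * χ' k x‖ ≤ 4 * ‖v‖ * |h x * (1 + ‖x‖)⁻¹| :=
    fun k => ae_of_all _ fun x => by
      rw [Real.norm_eq_abs, abs_mul, abs_mul, abs_of_pos (by positivity : 0 < (1 + ‖x‖)⁻¹)]
      calc |h x| * |χ' k x| ≤ |h x| * (4 * ‖v‖ * (1 + ‖x‖)⁻¹) := by
            gcongr; exact hχ'b k x
        _ = _ := by ring
  have hint1 : ∀ k, Integrable fun x => h' x * χ k x := fun k =>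
    hi'.abs.mono' (hi'.1.mul (hχc k).aestronglyMeasurable) (hb1 k)
  have hint2 : ∀ k, Integrable fun x => h x * χ' k x := fun k =>
    (hi.abs.const_mul _).mono' (hm.mul (hχ'c k).aestronglyMeasurable) (hb2 k)
  have hint3 : ∀ k, Integrable fun x => h x * χ k x := fun k => by
    refine (hi.abs.const_mul (2 / δ k)).mono' (hm.mul (hχc k).aestronglyMeasurable)
      (ae_of_all _ fun x => ?_)
    rw [Real.norm_eq_abs, abs_mul, abs_mul, abs_of_pos (by positivity : 0 < (1 + ‖x‖)⁻¹)]
    have hp := hpos k x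
    have : |χ k x| ≤ 2 / δ k * (1 + ‖x‖)⁻¹ := by
      simp only [χ]
      rw [abs_of_pos (inv_pos.2 hp), ← div_eq_mul_inv, inv_eq_one_div, div_div,
        div_le_div_iff₀ hp (mul_pos (hδ0 k) (by positivity))]
      have : ‖x‖ ≤ 1 + ‖x‖ ^ 2 := by nlinarith [sq_nonneg (‖x‖ - 1)]
      nlinarith [mul_le_mul_of_nonneg_left this (hδ0 k).le, hδ1 k, sq_nonneg ‖x‖, hδ0 k,
        mul_nonneg (hδ0 k).le (sq_nonneg ‖x‖)]
    calc |h x| * |χ k x| ≤ |h x| * (2 / δ k * (1 + ‖x‖)⁻¹) := by gcongr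
      _ = _ := by ring
  have hibp : ∀ k, ∫ x, h x * χ' k x = -∫ x, h' x * χ k x := fun k =>
    integral_bilinear_hasLineDerivAt_right_eq_neg_left_of_integrable
      (B := ContinuousLinearMap.mul ℝ ℝ) (hint1 k) (hint2 k) (hint3 k)
      (fun x _ => hd x) (fun x _ => hχd k x)
  have hden : ∀ x : E, Tendsto (fun k => 1 + δ k * ‖x‖ ^ 2) atTop (𝓝 1) := fun x => by
    simpa using (hδt.mul_const (‖x‖ ^ 2)).const_add 1
  have l1 : Tendsto (fun k => ∫ x, h' x * χ k x) atTop (𝓝 (∫ x, h' x)) := by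
    refine tendsto_integral_of_dominated_convergence _ (fun k => (hint1 k).1) hi'.abs hb1
      (ae_of_all _ fun x => ?_)
    simpa using ((hden x).inv₀ one_ne_zero).const_mul (h' x)
  have l2 : Tendsto (fun k => ∫ x, h x * χ' k x) atTop (𝓝 (∫ _ : E, (0 : ℝ))) := by
    refine tendsto_integral_of_dominated_convergence _ (fun k => (hint2 k).1)
      (hi.abs.const_mul _) hb2 (ae_of_all _ fun x => ?_)
    have := (((hδt.mul_const (2 * ⟪x, v⟫)).neg).div ((hden x).pow 2) (by norm_num)).const_mul (h x)
    simpa using this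
  have := tendsto_nhds_unique l2 (l1.neg.congr fun k => (hibp k).symm)
  simpa using this.symm

theorem ae_sub_notMem_span_singleton (hE : 2 ≤ Module.finrank ℝ E) (z₀ v : E) :
    ∀ᵐ z : E, z - z₀ ∉ Submodule.span ℝ {v} := by
  have hne : Submodule.span ℝ {v} ≠ ⊤ := by
    intro h
    have h1 := finrank_span_le_card (R := ℝ) ({v} : Set E)
    rw [h, finrank_top] at h1
    simp at h1
    omega
  have h0 := Measure.addHaar_submodule (volume : Measure E) _ hne
  rw [ae_iff]
  simp only [not_not]
  have := measure_preimage_add_right (volume : Measure E) (-z₀) (Submodule.span ℝ {v} : Set E)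
  rw [h0] at this
  simpa [sub_eq_add_neg, preimage] using this

/-- Integration by parts in the direction `v`, where one of the functions may be singular at a
point `z₀`. -/
theorem integral_mul_lineDeriv_eq_neg (hE : 2 ≤ Module.finrank ℝ E) {z₀ v : E}
    {f f' g g' : E → ℝ} (hf : ∀ z, z ≠ z₀ → HasLineDerivAt ℝ f (f' z) z v)
    (hg : ∀ z, HasLineDerivAt ℝ g (g' z) z v)
    (h1 : Integrable fun z => f z * g' z) (h2 : Integrable fun z => f' z * g z)
    (h3 : Integrable fun z => f z * g z * (1 + ‖z‖)⁻¹) :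
    ∫ z, f z * g' z = -∫ z, f' z * g z := by
  -- The line through `z₀` in direction `v` is null in dimension at least 2, and its complement is
  -- invariant under translation along `v`. Cutting the product off by the indicator of `S` thus
  -- makes it differentiable along `v` everywhere without changing any integral.
  let S : Set E := {z | z - z₀ ∉ Submodule.span ℝ {v}}
  have hS : ∀ᵐ z, z ∈ S := ae_sub_notMem_span_singleton hE z₀ v
  have hne : ∀ z ∈ S, z ≠ z₀ := by
    rintro z hz rfl
    exact hz (by simp)
  have hline : ∀ z (t : ℝ), z + t • v ∈ S ↔ z ∈ S := fun z t => by
    have : z + t • v - z₀ = (z - z₀) + t • v := by abel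
    simp only [S, mem_ofPred_eq, this]
    rw [Submodule.add_mem_iff_left _
      (Submodule.smul_mem _ _ (Submodule.mem_span_singleton_self v))]
  have hd : ∀ z, HasLineDerivAt ℝ (S.indicator fun z => f z * g z)
      (S.indicator (fun z => f z * g' z + f' z * g z) z) z v := by
    intro z
    by_cases hz : z ∈ S
    · have h := (hf z (hne z hz)).mul (hg z)
      simp only [zero_smul, add_zero] at h
      rw [indicator_of_mem hz]
      have e : (fun t : ℝ => S.indicator (fun z => f z * g z) (z + t • v)) =
          (fun t : ℝ => f (z + t • v)) * fun t : ℝ => g (z + t • v) := by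
        ext t; rw [indicator_of_mem ((hline z t).2 hz)]; rfl
      unfold HasLineDerivAt
      rw [e]
      convert! h using 1
      ring
    · rw [indicator_of_notMem hz]
      have e : (fun t : ℝ => S.indicator (fun z => f z * g z) (z + t • v)) = fun _ => 0 := by
        ext t; rw [indicator_of_notMem (fun h => hz ((hline z t).1 h))]
      unfold HasLineDerivAt
      rw [e]
      exact hasDerivAt_const _ _
  have e1 : S.indicator (fun z => f z * g' z + f' z * g z) =ᵐ[volume]
      fun z => f z * g' z + f' z * g z := by
    filter_upwards [hS] with z hz using indicator_of_mem hz _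
  have e2 : (fun z => S.indicator (fun z => f z * g z) z * (1 + ‖z‖)⁻¹) =ᵐ[volume]
      fun z => f z * g z * (1 + ‖z‖)⁻¹ := by
    filter_upwards [hS] with z hz
    rw [indicator_of_mem hz]
  have := integral_lineDeriv_eq_zero hd ((h1.add h2).congr e1.symm) (h3.congr e2.symm)
  rw [integral_congr_ae e1, integral_add h1 h2] at this
  linarith

end IntegrationByParts

/-! ### The regularized Newton kernel: derivatives, decay and integrals. -/

section Kernel

set_option linter.unusedSectionVars false

variable {E : Type*} [NormedAddCommGroup E] [InnerProductSpace ℝ E]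

/-- The inverse Japanese bracket `(1 + |z|²)^{-1/2}`. -/
def invBracket (z : E) : ℝ := (√(1 + ‖z‖ ^ 2))⁻¹

theorem invBracket_pos (z : E) : 0 < invBracket z := by unfold invBracket; positivity

theorem invBracket_sq_mul (z : E) : invBracket z ^ 2 * (1 + ‖z‖ ^ 2) = 1 := by
  unfold invBracket
  have h : 0 < 1 + ‖z‖ ^ 2 := by positivity
  rw [inv_pow, Real.sq_sqrt h.le, inv_mul_cancel₀ h.ne']

theorem invBracket_le_one (z : E) : invBracket z ≤ 1 := by
  have h := invBracket_sq_mul z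
  have h0 := invBracket_pos z
  by_contra! h1
  nlinarith [mul_nonneg (sq_nonneg (invBracket z)) (sq_nonneg ‖z‖)]

theorem norm_mul_invBracket_le (z : E) : ‖z‖ * invBracket z ≤ 1 := by
  have h := invBracket_sq_mul z
  have h0 := invBracket_pos z
  refine (sq_le_sq₀ (by positivity) zero_le_one).1 ?_
  nlinarith

theorem inv_one_add_norm_le_invBracket (z : E) : (1 + ‖z‖)⁻¹ ≤ invBracket z := by
  unfold invBracket
  refine inv_anti₀ (by positivity) ?_
  rw [Real.sqrt_le_left (by positivity)]
  nlinarith [norm_nonneg z]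

theorem abs_inner_mul_invBracket_le (z v : E) : |⟪z, v⟫| * invBracket z ≤ ‖v‖ := by
  have h1 := abs_real_inner_le_norm z v
  have h0 := invBracket_pos z
  calc |⟪z, v⟫| * invBracket z ≤ ‖z‖ * ‖v‖ * invBracket z := by gcongr
    _ = ‖v‖ * (‖z‖ * invBracket z) := by ring
    _ ≤ ‖v‖ * 1 := by gcongr; exact norm_mul_invBracket_le z
    _ = _ := mul_one _

theorem continuous_invBracket : Continuous (invBracket : E → ℝ) := by
  unfold invBracket
  refine Continuous.inv₀ (by fun_prop) fun z => ?_
  positivity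

theorem hasDerivAt_invBracket_line (z v : E) :
    HasDerivAt (fun τ : ℝ => invBracket (z + τ • v)) (-invBracket z ^ 3 * ⟪z, v⟫) 0 := by
  have h1 := (hasDerivAt_norm_sq_line z v).const_add 1
  have hp : 0 < 1 + ‖z‖ ^ 2 := by positivity
  have h2 := h1.sqrt (by simpa using hp.ne')
  have h3 := h2.inv (by simp only [zero_smul, add_zero]; positivity)
  simp only [zero_smul, add_zero] at h3
  refine h3.congr_deriv ?_
  unfold invBracket
  have : √(1 + ‖z‖ ^ 2) ≠ 0 := by positivity
  field_simp

theorem hasDerivAt_invBracket_pow_line (k : ℕ) (z v : E) :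
    HasDerivAt (fun τ : ℝ => invBracket (z + τ • v) ^ k)
      (-(k * invBracket z ^ (k + 2) * ⟪z, v⟫)) 0 := by
  refine ((hasDerivAt_invBracket_line z v).pow k).congr_deriv ?_
  rcases k with _ | k
  · simp
  · simp only [zero_smul, add_zero, Nat.add_sub_cancel]
    push_cast
    ring

/-- Up to the factor `ω_n⁻¹`, the second derivative in the direction `ξ` of the regularized
Newton potential `-(1 + |z|²)^{-(m-2)/2} / (m - 2)`. -/
def kernel (m : ℕ) (ξ z : E) : ℝ :=
  invBracket z ^ m - m * ⟪z, ξ⟫ ^ 2 * invBracket z ^ (m + 2)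

def kernelDeriv (m : ℕ) (ξ v z : E) : ℝ :=
  -(m * invBracket z ^ (m + 2) * ⟪z, v⟫) - 2 * m * ⟪z, ξ⟫ * ⟪v, ξ⟫ * invBracket z ^ (m + 2) +
    m * (m + 2) * ⟪z, ξ⟫ ^ 2 * invBracket z ^ (m + 4) * ⟪z, v⟫

def kernelDeriv₂ (m : ℕ) (ξ v z : E) : ℝ :=
  m * (m + 2) * invBracket z ^ (m + 4) * ⟪z, v⟫ ^ 2 - m * invBracket z ^ (m + 2) * ⟪v, v⟫ -
    2 * m * ⟪v, ξ⟫ ^ 2 * invBracket z ^ (m + 2) +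
    4 * m * (m + 2) * ⟪z, ξ⟫ * ⟪v, ξ⟫ * invBracket z ^ (m + 4) * ⟪z, v⟫ +
    m * (m + 2) * ⟪z, ξ⟫ ^ 2 * invBracket z ^ (m + 4) * ⟪v, v⟫ -
    m * (m + 2) * (m + 4) * ⟪z, ξ⟫ ^ 2 * invBracket z ^ (m + 6) * ⟪z, v⟫ ^ 2

/-- The Laplacian of `kernel`. -/
def kernelLaplacian (m : ℕ) (ξ z : E) : ℝ :=
  m * (m + 2) * (-invBracket z ^ (m + 4) + (m + 4) * ⟪z, ξ⟫ ^ 2 * invBracket z ^ (m + 6))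

theorem hasLineDerivAt_kernel (m : ℕ) (ξ v z : E) :
    HasLineDerivAt ℝ (kernel m ξ) (kernelDeriv m ξ v z) z v := by
  have hq := hasDerivAt_invBracket_pow_line (z := z) (v := v)
  have ht := hasDerivAt_inner_line z v ξ
  have h := (hq m).sub (((ht.pow 2).const_mul (m : ℝ)).mul (hq (m + 2)))
  refine h.congr_deriv ?_
  simp only [zero_smul, add_zero, kernelDeriv, Pi.pow_apply]
  push_cast
  ring

theorem hasLineDerivAt_kernelDeriv (m : ℕ) (ξ v z : E) :
    HasLineDerivAt ℝ (kernelDeriv m ξ v) (kernelDeriv₂ m ξ v z) z v := by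
  have hq := hasDerivAt_invBracket_pow_line (z := z) (v := v)
  have ht := hasDerivAt_inner_line z v ξ
  have hv := hasDerivAt_inner_line z v v
  have h := (((((hq (m + 2)).const_mul (m : ℝ)).mul hv).neg).sub
    (((ht.const_mul (2 * (m : ℝ))).mul_const ⟪v, ξ⟫).mul (hq (m + 2)))).add
    ((((ht.pow 2).const_mul ((m : ℝ) * (m + 2))).mul (hq (m + 4))).mul hv)
  refine h.congr_deriv ?_
  simp only [zero_smul, add_zero, kernelDeriv₂, Pi.pow_apply, Pi.mul_apply]
  push_cast
  ring

/-- With `q = invBracket z`, the relation `q²‖z‖² = 1 - q²` collapses the trace. The result is also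
the second `ξ`-derivative of `m q^(m+2)`, the Laplacian of the regularized potential; this second
reading is what makes it an approximation of `∂_ξξ`. -/
theorem sum_kernelDeriv₂ {ι : Type*} [Fintype ι] (b : OrthonormalBasis ι ℝ E)
    {m : ℕ} (hm : Fintype.card ι = m) {ξ : E} (hξ : ‖ξ‖ = 1) (z : E) :
    ∑ i, kernelDeriv₂ m ξ (b i) z = kernelLaplacian m ξ z := by
  have e1 : ∑ i, ⟪z, b i⟫ ^ 2 = ‖z‖ ^ 2 := by
    rw [← b.sum_sq_norm_inner_left z]; simp
  have e2 : ∑ i, ⟪b i, ξ⟫ ^ 2 = 1 := by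
    have := b.sum_sq_norm_inner_right ξ
    rw [hξ] at this
    simpa using this
  have e3 : ∑ i, ⟪b i, ξ⟫ * ⟪z, b i⟫ = ⟪z, ξ⟫ := by
    rw [← b.sum_inner_mul_inner z ξ]
    exact Finset.sum_congr rfl fun i _ => mul_comm _ _
  have e4 : ∑ i, ⟪b i, b i⟫ = (m : ℝ) := by
    simp [hm]
  set q := invBracket z
  set t := ⟪z, ξ⟫
  have h : ∑ i, kernelDeriv₂ m ξ (b i) z =
      m * (m + 2) * q ^ (m + 4) * ∑ i, ⟪z, b i⟫ ^ 2 - m * q ^ (m + 2) * ∑ i, ⟪b i, b i⟫ -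
      2 * m * q ^ (m + 2) * ∑ i, ⟪b i, ξ⟫ ^ 2 +
      4 * m * (m + 2) * t * q ^ (m + 4) * ∑ i, ⟪b i, ξ⟫ * ⟪z, b i⟫ +
      m * (m + 2) * t ^ 2 * q ^ (m + 4) * ∑ i, ⟪b i, b i⟫ -
      m * (m + 2) * (m + 4) * t ^ 2 * q ^ (m + 6) * ∑ i, ⟪z, b i⟫ ^ 2 := by
    simp only [Finset.mul_sum, ← Finset.sum_sub_distrib, ← Finset.sum_add_distrib]
    refine Finset.sum_congr rfl fun i _ => ?_
    simp only [kernelDeriv₂]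
    ring
  rw [h, e1, e2, e3, e4, kernelLaplacian]
  have hq : q ^ 2 * (1 + ‖z‖ ^ 2) = 1 := invBracket_sq_mul z
  have hz : q ^ 2 * ‖z‖ ^ 2 = 1 - q ^ 2 := by linarith
  have h4 : q ^ (m + 4) * ‖z‖ ^ 2 = q ^ (m + 2) * (1 - q ^ 2) := by rw [← hz]; ring
  have h6 : q ^ (m + 6) * ‖z‖ ^ 2 = q ^ (m + 4) * (1 - q ^ 2) := by rw [← hz]; ring
  linear_combination (m * (m + 2) : ℝ) * h4 - (m * (m + 2) * (m + 4) * t ^ 2 : ℝ) * h6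

/-- The kernel is `q^m (1 - m s²)` with `s = ⟪z, ξ⟫ q` in `[-1, 1]`, and `|1 - m s²|` is at most `m
- 1` once `m ≥ 2`. This sharp constant becomes the factor `n` in the final estimate. -/
theorem abs_kernel_le {m : ℕ} (hm : 2 ≤ m) {ξ : E} (hξ : ‖ξ‖ = 1) (z : E) :
    |kernel m ξ z| ≤ (m - 1) * invBracket z ^ m := by
  have h := abs_inner_mul_invBracket_le z ξ
  have h0 := invBracket_pos z
  rw [hξ] at h
  have h1 : (⟪z, ξ⟫ * invBracket z) ^ 2 ≤ 1 := by
    rw [sq_le_one_iff_abs_le_one, abs_mul, abs_of_pos h0]; exact h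
  have hm' : (2 : ℝ) ≤ m := by exact_mod_cast hm
  have e : kernel m ξ z = invBracket z ^ m * (1 - m * (⟪z, ξ⟫ * invBracket z) ^ 2) := by
    unfold kernel; ring
  rw [e, abs_mul, abs_of_pos (pow_pos h0 m), mul_comm]
  gcongr
  rw [abs_le]
  constructor <;> nlinarith [sq_nonneg (⟪z, ξ⟫ * invBracket z)]

theorem abs_kernelDeriv_le (m : ℕ) {ξ v : E} (hξ : ‖ξ‖ = 1) (hv : ‖v‖ = 1) (z : E) :
    |kernelDeriv m ξ v z| ≤ (m + 2 * m + m * (m + 2)) * invBracket z ^ (m + 1) := by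
  have h0 := invBracket_pos z
  have hA := abs_inner_mul_invBracket_le z ξ
  have hB := abs_inner_mul_invBracket_le z v
  have hC : |⟪v, ξ⟫| ≤ 1 := by simpa [hξ, hv] using abs_real_inner_le_norm v ξ
  rw [hξ] at hA
  rw [hv] at hB
  set q := invBracket z
  have e : kernelDeriv m ξ v z = q ^ (m + 1) * (-(m * (⟪z, v⟫ * q)) -
      2 * m * ((⟪z, ξ⟫ * q) * ⟪v, ξ⟫) + m * (m + 2) * ((⟪z, ξ⟫ * q) ^ 2 * (⟪z, v⟫ * q))) := by
    unfold kernelDeriv; ring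
  have hA' : |⟪z, ξ⟫ * q| ≤ 1 := by rw [abs_mul, abs_of_pos h0]; exact hA
  have hB' : |⟪z, v⟫ * q| ≤ 1 := by rw [abs_mul, abs_of_pos h0]; exact hB
  have i1 : |(⟪z, ξ⟫ * q) * ⟪v, ξ⟫| ≤ 1 := by
    rw [abs_mul]; exact mul_le_one₀ hA' (abs_nonneg _) hC
  have i2 : |(⟪z, ξ⟫ * q) ^ 2 * (⟪z, v⟫ * q)| ≤ 1 := by
    rw [abs_mul, abs_pow]
    exact mul_le_one₀ (pow_le_one₀ (abs_nonneg _) hA') (abs_nonneg _) hB'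
  rw [e, abs_mul, abs_of_pos (pow_pos h0 _), mul_comm]
  gcongr
  rw [abs_le] at *
  have hm : (0 : ℝ) ≤ m := Nat.cast_nonneg m
  constructor <;> nlinarith [mul_nonneg hm (by linarith : (0 : ℝ) ≤ m + 2)]

theorem abs_kernelDeriv₂_le (m : ℕ) {ξ v : E} (hξ : ‖ξ‖ = 1) (hv : ‖v‖ = 1) (z : E) :
    |kernelDeriv₂ m ξ v z| ≤ (3 * m + 6 * m * (m + 2) + m * (m + 2) * (m + 4)) *
      invBracket z ^ (m + 2) := by
  have h0 := invBracket_pos z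
  have hA := abs_inner_mul_invBracket_le z ξ
  have hB := abs_inner_mul_invBracket_le z v
  have hC : |⟪v, ξ⟫| ≤ 1 := by simpa [hξ, hv] using abs_real_inner_le_norm v ξ
  rw [hξ] at hA
  rw [hv] at hB
  have hvv : ⟪v, v⟫ = 1 := by rw [real_inner_self_eq_norm_sq, hv]; norm_num
  set q := invBracket z
  have e : kernelDeriv₂ m ξ v z = q ^ (m + 2) * (m * (m + 2) * (⟪z, v⟫ * q) ^ 2 - m * 1 -
      2 * m * ⟪v, ξ⟫ ^ 2 + 4 * m * (m + 2) * ((⟪z, ξ⟫ * q) * ⟪v, ξ⟫ * (⟪z, v⟫ * q)) +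
      m * (m + 2) * (⟪z, ξ⟫ * q) ^ 2 -
      m * (m + 2) * (m + 4) * ((⟪z, ξ⟫ * q) ^ 2 * (⟪z, v⟫ * q) ^ 2)) := by
    unfold kernelDeriv₂; rw [hvv]; ring
  have hA' : |⟪z, ξ⟫ * q| ≤ 1 := by rw [abs_mul, abs_of_pos h0]; exact hA
  have hB' : |⟪z, v⟫ * q| ≤ 1 := by rw [abs_mul, abs_of_pos h0]; exact hB
  have i1 : |(⟪z, ξ⟫ * q) * ⟪v, ξ⟫ * (⟪z, v⟫ * q)| ≤ 1 := by
    rw [abs_mul, abs_mul]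
    exact mul_le_one₀ (mul_le_one₀ hA' (abs_nonneg _) hC) (abs_nonneg _) hB'
  have i2 : (⟪z, ξ⟫ * q) ^ 2 ≤ 1 := by rwa [sq_le_one_iff_abs_le_one]
  have i3 : (⟪z, v⟫ * q) ^ 2 ≤ 1 := by rwa [sq_le_one_iff_abs_le_one]
  have i4 : ⟪v, ξ⟫ ^ 2 ≤ 1 := by rwa [sq_le_one_iff_abs_le_one]
  have i5 : (⟪z, ξ⟫ * q) ^ 2 * (⟪z, v⟫ * q) ^ 2 ≤ 1 := mul_le_one₀ i2 (sq_nonneg _) i3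
  have j2 := sq_nonneg (⟪z, ξ⟫ * q)
  have j3 := sq_nonneg (⟪z, v⟫ * q)
  have j4 := sq_nonneg ⟪v, ξ⟫
  have j5 := mul_nonneg j2 j3
  rw [e, abs_mul, abs_of_pos (pow_pos h0 _), mul_comm]
  gcongr
  generalize (⟪z, ξ⟫ * q) ^ 2 * (⟪z, v⟫ * q) ^ 2 = x5 at *
  generalize (⟪z, ξ⟫ * q) * ⟪v, ξ⟫ * (⟪z, v⟫ * q) = x1 at *
  generalize (⟪z, ξ⟫ * q) ^ 2 = x2 at *
  generalize (⟪z, v⟫ * q) ^ 2 = x3 at *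
  generalize ⟪v, ξ⟫ ^ 2 = x4 at *
  have hm : (0 : ℝ) ≤ m := Nat.cast_nonneg m
  have hm2 : (0 : ℝ) ≤ m * (m + 2) := by positivity
  have hm4 : (0 : ℝ) ≤ m * (m + 2) * (m + 4) := by positivity
  rw [abs_le] at i1 ⊢
  generalize (m : ℝ) * (m + 2) * (m + 4) = c4 at *
  have e1 : 4 * (m : ℝ) * (m + 2) = 4 * (m * (m + 2)) := by ring
  have e2 : 6 * (m : ℝ) * (m + 2) = 6 * (m * (m + 2)) := by ring
  rw [e1, e2]
  generalize (m : ℝ) * (m + 2) = c2 at *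
  generalize (m : ℝ) = c at *
  constructor
  · nlinarith [mul_nonneg hm2 j3, mul_le_mul_of_nonneg_left i4 hm,
      mul_le_mul_of_nonneg_left i1.1 hm2, mul_nonneg hm2 j2, mul_le_mul_of_nonneg_left i5 hm4]
  · nlinarith [mul_le_mul_of_nonneg_left i3 hm2, mul_nonneg hm j4,
      mul_le_mul_of_nonneg_left i1.2 hm2, mul_le_mul_of_nonneg_left i2 hm2, mul_nonneg hm4 j5]

theorem continuous_kernel (m : ℕ) (ξ : E) : Continuous (kernel m ξ) := by
  have := continuous_invBracket (E := E)
  unfold kernel; fun_prop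

theorem continuous_kernelDeriv (m : ℕ) (ξ v : E) : Continuous (kernelDeriv m ξ v) := by
  have := continuous_invBracket (E := E)
  unfold kernelDeriv; fun_prop

theorem continuous_kernelDeriv₂ (m : ℕ) (ξ v : E) : Continuous (kernelDeriv₂ m ξ v) := by
  have := continuous_invBracket (E := E)
  unfold kernelDeriv₂; fun_prop

theorem continuous_kernelLaplacian (m : ℕ) (ξ : E) : Continuous (kernelLaplacian m ξ) := by
  have := continuous_invBracket (E := E)
  unfold kernelLaplacian; fun_prop

theorem abs_kernelLaplacian_le (m : ℕ) {ξ : E} (hξ : ‖ξ‖ = 1) (z : E) :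
    |kernelLaplacian m ξ z| ≤ m * (m + 2) * (m + 5) * invBracket z ^ (m + 4) := by
  have h0 := invBracket_pos z
  have hA := abs_inner_mul_invBracket_le z ξ
  rw [hξ] at hA
  set q := invBracket z
  have hA' : |⟪z, ξ⟫ * q| ≤ 1 := by rw [abs_mul, abs_of_pos h0]; exact hA
  have i2 : (⟪z, ξ⟫ * q) ^ 2 ≤ 1 := by rwa [sq_le_one_iff_abs_le_one]
  have e : kernelLaplacian m ξ z =
      m * (m + 2) * q ^ (m + 4) * (-1 + (m + 4) * (⟪z, ξ⟫ * q) ^ 2) := by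
    unfold kernelLaplacian; ring
  have hm : (0 : ℝ) ≤ m := Nat.cast_nonneg m
  rw [e, abs_mul, abs_of_nonneg (by positivity : (0 : ℝ) ≤ m * (m + 2) * q ^ (m + 4))]
  have : |-1 + (m + 4) * (⟪z, ξ⟫ * q) ^ 2| ≤ (m : ℝ) + 5 := by
    rw [abs_le]
    constructor <;> nlinarith [sq_nonneg (⟪z, ξ⟫ * q)]
  calc _ ≤ m * (m + 2) * q ^ (m + 4) * (m + 5 : ℝ) := by gcongr
    _ = _ := by ring

variable [FiniteDimensional ℝ E] [MeasurableSpace E] [BorelSpace E]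

/-- In polar coordinates, with `m` the dimension, the radial integrand is `(r q)^(m-2) q² ≤ (1 +
r²)⁻¹`. -/
theorem integrable_inv_norm_mul_invBracket_pow (hE : 2 ≤ Module.finrank ℝ E) :
    Integrable fun z : E => ‖z‖⁻¹ * invBracket z ^ Module.finrank ℝ E := by
  have : Nontrivial E := Module.nontrivial_of_finrank_pos (R := ℝ) (by omega)
  have h := integrable_fun_norm_addHaar (volume : Measure E)
    (f := fun r : ℝ => r⁻¹ * (√(1 + r ^ 2))⁻¹ ^ Module.finrank ℝ E)
  refine h.2 ?_
  obtain ⟨k, hk⟩ := Nat.exists_eq_add_of_le hE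
  rw [hk]
  refine (integrable_inv_one_add_sq.integrableOn (s := Ioi 0)).mono' (by fun_prop) ?_
  refine (ae_restrict_iff' measurableSet_Ioi).2 (ae_of_all _ fun r hr => ?_)
  have hr : 0 < r := hr
  have e : (√(1 + r ^ 2))⁻¹ = invBracket r := by simp [invBracket]
  have h0 := invBracket_pos r
  have h1 := norm_mul_invBracket_le r
  have h2 := invBracket_sq_mul r
  rw [e]
  rw [Real.norm_eq_abs] at h1 h2
  rw [abs_of_pos hr] at h1
  rw [sq_abs] at h2
  have e2 : (1 + r ^ 2)⁻¹ = invBracket r ^ 2 := inv_eq_of_mul_eq_one_left h2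
  rw [e2, smul_eq_mul, Real.norm_eq_abs, abs_of_nonneg (by positivity)]
  have e3 : r ^ (2 + k - 1) * (r⁻¹ * invBracket r ^ (2 + k)) =
      (r * invBracket r) ^ k * invBracket r ^ 2 := by
    rw [show 2 + k - 1 = k + 1 by omega]
    field_simp
    ring
  rw [e3]
  exact mul_le_of_le_one_left (by positivity) (pow_le_one₀ (by positivity) h1)

/-- A Peetre-type inequality: moving the centre costs only a constant, so the singularity `‖z‖⁻¹`
can be translated to any point. -/
theorem invBracket_le_mul_sub (z z₀ : E) :
    invBracket z ≤ √(2 * (1 + ‖z₀‖ ^ 2)) * invBracket (z - z₀) := by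
  have h1 := invBracket_sq_mul z
  have h2 := invBracket_sq_mul (z - z₀)
  have p1 := invBracket_pos z
  have p2 := invBracket_pos (z - z₀)
  refine (sq_le_sq₀ p1.le (by positivity)).1 ?_
  rw [mul_pow, Real.sq_sqrt (by positivity)]
  have hn : ‖z - z₀‖ ^ 2 ≤ 2 * ‖z‖ ^ 2 + 2 * ‖z₀‖ ^ 2 := by
    have := norm_sub_le z z₀
    nlinarith [sq_nonneg (‖z‖ - ‖z₀‖), norm_nonneg (z - z₀), norm_nonneg z, norm_nonneg z₀]
  have h3 : 1 + ‖z - z₀‖ ^ 2 ≤ 2 * (1 + ‖z₀‖ ^ 2) * (1 + ‖z‖ ^ 2) := by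
    nlinarith [mul_nonneg (sq_nonneg ‖z₀‖) (sq_nonneg ‖z‖)]
  have h4 := mul_le_mul_of_nonneg_left h3
    (by positivity : 0 ≤ invBracket z ^ 2 * invBracket (z - z₀) ^ 2)
  calc invBracket z ^ 2 = invBracket z ^ 2 * (invBracket (z - z₀) ^ 2 * (1 + ‖z - z₀‖ ^ 2)) := by
        rw [h2, mul_one]
    _ ≤ invBracket z ^ 2 * invBracket (z - z₀) ^ 2 * (2 * (1 + ‖z₀‖ ^ 2) * (1 + ‖z‖ ^ 2)) := by
        linarith
    _ = 2 * (1 + ‖z₀‖ ^ 2) * invBracket (z - z₀) ^ 2 * (invBracket z ^ 2 * (1 + ‖z‖ ^ 2)) := by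
        ring
    _ = _ := by rw [h1, mul_one]

theorem integrable_inv_norm_sub_mul_invBracket_pow (hE : 2 ≤ Module.finrank ℝ E) (z₀ : E) :
    Integrable fun z : E => ‖z - z₀‖⁻¹ * invBracket z ^ Module.finrank ℝ E := by
  have h := ((integrable_inv_norm_mul_invBracket_pow hE).comp_sub_right z₀).const_mul
    (√(2 * (1 + ‖z₀‖ ^ 2)) ^ Module.finrank ℝ E)
  have hc := continuous_invBracket (E := E)
  refine h.mono' ?_ (ae_of_all _ fun z => ?_)
  · exact ((by fun_prop : Measurable fun z : E => ‖z - z₀‖⁻¹).mul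
      (by fun_prop)).aestronglyMeasurable
  · have p1 := invBracket_pos z
    rw [Real.norm_eq_abs, abs_of_nonneg (by positivity)]
    calc ‖z - z₀‖⁻¹ * invBracket z ^ Module.finrank ℝ E
        ≤ ‖z - z₀‖⁻¹ * (√(2 * (1 + ‖z₀‖ ^ 2)) * invBracket (z - z₀)) ^ Module.finrank ℝ E := by
          gcongr; exact invBracket_le_mul_sub z z₀
      _ = _ := by rw [mul_pow]; ring

theorem integrable_invBracket_pow (hE : 2 ≤ Module.finrank ℝ E) :
    Integrable fun z : E => invBracket z ^ (Module.finrank ℝ E + 1) := by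
  have : Nontrivial E := Module.nontrivial_of_finrank_pos (R := ℝ) (by omega)
  have hc := continuous_invBracket (E := E)
  refine (integrable_inv_norm_mul_invBracket_pow hE).mono'
    (by fun_prop : Continuous _).aestronglyMeasurable ?_
  filter_upwards [Measure.ae_ne (volume : Measure E) 0] with z hz
  have p1 := invBracket_pos z
  have hz' : 0 < ‖z‖ := norm_pos_iff.2 hz
  rw [Real.norm_eq_abs, abs_of_nonneg (by positivity), pow_succ, mul_comm]
  gcongr
  rw [le_inv_comm₀ p1 hz', le_inv_comm₀ hz' p1, ← one_div, le_div_iff₀ hz', mul_comm]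
  exact norm_mul_invBracket_le z

/-- Since `(r q)' = q³`, the radial integrand `m r^(m-1) q^(m+2)` is the derivative of `(r q)^m`,
which runs from 0 to 1. This is the total mass of the approximate identity. -/
theorem integral_invBracket_pow (hE : 2 ≤ Module.finrank ℝ E) :
    Module.finrank ℝ E * ∫ z : E, invBracket z ^ (Module.finrank ℝ E + 2) =
      (volume : Measure E).toSphere.real univ := by
  have : Nontrivial E := Module.nontrivial_of_finrank_pos (R := ℝ) (by omega)
  obtain ⟨k, hk⟩ := Nat.exists_eq_add_of_le (show 1 ≤ Module.finrank ℝ E by omega)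
  have h := integral_fun_norm_addHaar (volume : Measure E)
    (fun r : ℝ => (√(1 + r ^ 2))⁻¹ ^ (Module.finrank ℝ E + 2))
  rw [Measure.toSphere_real_apply_univ]
  simp only [invBracket]
  rw [h]
  rw [hk]
  have hd : ∀ r ∈ Ici (0 : ℝ), HasDerivAt (fun r : ℝ => (r * invBracket r) ^ (1 + k))
      ((1 + k) * (r ^ (1 + k - 1) • (√(1 + r ^ 2))⁻¹ ^ (1 + k + 2))) r := by
    intro r _
    have h1 : HasDerivAt (fun s : ℝ => invBracket s) (-invBracket r ^ 3 * r) r := by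
      have h2 : HasDerivAt (fun τ : ℝ => invBracket (r + τ • (1 : ℝ))) (-invBracket r ^ 3 * r)
          (r - r) := by
        simpa using hasDerivAt_invBracket_line r (1 : ℝ)
      have := h2.comp_sub_const r r
      simpa using this
    refine (((hasDerivAt_id r).mul h1).pow (1 + k)).congr_deriv ?_
    have e : (√(1 + r ^ 2))⁻¹ = invBracket r := by simp [invBracket]
    have h2 := invBracket_sq_mul r
    rw [Real.norm_eq_abs, sq_abs] at h2
    rw [e]
    simp only [id, Pi.mul_apply, Nat.add_sub_cancel_left, smul_eq_mul]
    push_cast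
    have h3 : invBracket r ^ 3 * r * r = invBracket r * (1 - invBracket r ^ 2) := by
      linear_combination invBracket r * h2
    calc _ = (1 + k : ℝ) * (r * invBracket r) ^ k *
          (invBracket r - invBracket r ^ 3 * r * r) := by ring
      _ = _ := by rw [h3]; ring
  have hlim : Tendsto (fun r : ℝ => (r * invBracket r) ^ (1 + k)) atTop (𝓝 (1 ^ (1 + k))) := by
    refine Tendsto.pow ?_ _
    have h1 : Tendsto (fun r : ℝ => √(1 - (1 + r ^ 2)⁻¹)) atTop (𝓝 1) := by
      have : Tendsto (fun r : ℝ => (1 + r ^ 2)⁻¹) atTop (𝓝 0) :=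
        (tendsto_atTop_add_const_left _ _ (tendsto_pow_atTop two_ne_zero)).inv_tendsto_atTop
      simpa using (this.const_sub 1).sqrt
    refine h1.congr' ?_
    filter_upwards [eventually_ge_atTop 0] with r hr
    have p := invBracket_pos r
    have h2 := invBracket_sq_mul r
    rw [Real.norm_eq_abs, sq_abs] at h2
    rw [Real.sqrt_eq_iff_mul_self_eq _ (by positivity)]
    · have : (1 + r ^ 2)⁻¹ = invBracket r ^ 2 := by
        field_simp; linarith
      rw [this]
      linarith
    · rw [sub_nonneg]; apply inv_le_one_of_one_le₀; nlinarith
  have hint := integral_Ioi_of_hasDerivAt_of_nonneg' hd (fun r hr => by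
    have hr : (0 : ℝ) < r := hr
    positivity) hlim
  rw [integral_const_mul] at hint
  simp only [one_pow, zero_mul, ne_eq, Nat.add_eq_zero_iff, one_ne_zero, false_and,
    not_false_eq_true, zero_pow, sub_zero] at hint
  rw [nsmul_eq_mul, smul_eq_mul]
  push_cast
  linear_combination ((1 + k : ℝ) * (volume : Measure E).real (Metric.ball 0 1)) * hint

end Kernel

/-! ### Recovering second derivatives from the Laplacian. -/

section Representation

set_option linter.unusedSectionVars false

variable {E : Type*} [NormedAddCommGroup E] [InnerProductSpace ℝ E]
  [FiniteDimensional ℝ E] [MeasurableSpace E] [BorelSpace E]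

theorem integrable_of_abs_le_invBracket_pow (hE : 2 ≤ Module.finrank ℝ E) {F : E → ℝ}
    (hF : AEStronglyMeasurable F) {C : ℝ}
    (hb : ∀ z, |F z| ≤ C * invBracket z ^ (Module.finrank ℝ E + 1)) : Integrable F :=
  ((integrable_invBracket_pow hE).const_mul C).mono' hF (ae_of_all _ hb)

/-- Green's identity for a function of linear growth with an isolated mild singularity `z₀`
against the regularized kernel. -/
theorem integral_mul_kernelLaplacian (hE : 2 ≤ Module.finrank ℝ E) {ι : Type*} [Fintype ι]
    (b : OrthonormalBasis ι ℝ E) {ξ : E} (hξ : ‖ξ‖ = 1) {z₀ : E} {C : ℝ} {V : E → ℝ}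
    {V₁ V₂ : ι → E → ℝ} (mV : AEStronglyMeasurable V)
    (m₁ : ∀ i, AEStronglyMeasurable (V₁ i)) (m₂ : ∀ i, AEStronglyMeasurable (V₂ i))
    (bV : ∀ z, |V z| * invBracket z ≤ C) (b₁ : ∀ i z, |V₁ i z| ≤ C)
    (b₂ : ∀ i z, z ≠ z₀ → |V₂ i z| ≤ C * ‖z - z₀‖⁻¹)
    (d₁ : ∀ i z, z ≠ z₀ → HasLineDerivAt ℝ V (V₁ i z) z (b i))
    (d₂ : ∀ i z, z ≠ z₀ → HasLineDerivAt ℝ (V₁ i) (V₂ i z) z (b i)) :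
    ∫ z, V z * kernelLaplacian (Module.finrank ℝ E) ξ z =
      ∫ z, (∑ i, V₂ i z) * kernel (Module.finrank ℝ E) ξ z := by
  set m := Module.finrank ℝ E with hm
  have hb : ∀ i, ‖b i‖ = 1 := fun i => b.orthonormal.1 i
  have hC : 0 ≤ C := le_trans (by have := invBracket_pos (0 : E); positivity) (bV 0)
  have mk := fun ξ : E => (continuous_kernel m ξ).aestronglyMeasurable (μ := (volume : Measure E))
  have mk₁ := fun ξ v : E =>
    (continuous_kernelDeriv m ξ v).aestronglyMeasurable (μ := (volume : Measure E))
  have mk₂ := fun ξ v : E =>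
    (continuous_kernelDeriv₂ m ξ v).aestronglyMeasurable (μ := (volume : Measure E))
  have mw : AEStronglyMeasurable (fun z : E => (1 + ‖z‖)⁻¹) :=
    (by fun_prop : Measurable fun z : E => (1 + ‖z‖)⁻¹).aestronglyMeasurable
  have hw : ∀ z : E, |(1 + ‖z‖)⁻¹| ≤ invBracket z := fun z => by
    rw [abs_of_pos (by positivity)]; exact inv_one_add_norm_le_invBracket z
  have hm2 : (0 : ℝ) ≤ m - 1 := by
    have : (2 : ℝ) ≤ m := by exact_mod_cast hE
    linarith
  have k₀ := fun z : E => abs_kernel_le hE hξ z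
  have k₁ := fun i (z : E) => abs_kernelDeriv_le m hξ (hb i) z
  have k₂ := fun i (z : E) => abs_kernelDeriv₂_le m hξ (hb i) z
  set c₁ : ℝ := m + 2 * m + m * (m + 2)
  set c₂ : ℝ := 3 * m + 6 * m * (m + 2) + m * (m + 2) * (m + 4)
  have hq := fun z : E => (invBracket_pos z).le
  have I2 : ∀ i, Integrable fun z => V z * kernelDeriv₂ m ξ (b i) z := fun i => by
    refine integrable_of_abs_le_invBracket_pow hE (C := C * c₂) (mV.mul (mk₂ _ _)) fun z => ?_
    rw [abs_mul]
    calc |V z| * |kernelDeriv₂ m ξ (b i) z| ≤ |V z| * (c₂ * invBracket z ^ (m + 2)) := by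
          gcongr; exact k₂ i z
      _ = (|V z| * invBracket z) * (c₂ * invBracket z ^ (m + 1)) := by ring
      _ ≤ C * (c₂ * invBracket z ^ (m + 1)) := by
          have := hq z
          gcongr; exact bV z
      _ = _ := by ring
  have I1 : ∀ i, Integrable fun z => V₁ i z * kernelDeriv m ξ (b i) z := fun i => by
    refine integrable_of_abs_le_invBracket_pow hE (C := C * c₁) ((m₁ i).mul (mk₁ _ _)) fun z => ?_
    rw [abs_mul]
    calc |V₁ i z| * |kernelDeriv m ξ (b i) z| ≤ C * (c₁ * invBracket z ^ (m + 1)) := by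
          gcongr
          · exact b₁ i z
          · exact k₁ i z
      _ = _ := by ring
  -- The kernel itself decays only like `‖z‖^(-m)`, which is not integrable at infinity; the missing
  -- decay comes from the factor `‖z - z₀‖⁻¹` in the bound for `V₂`.
  have I0 : ∀ i, Integrable fun z => V₂ i z * kernel m ξ z := fun i => by
    refine ((integrable_inv_norm_sub_mul_invBracket_pow hE z₀).const_mul (C * (m - 1))).mono'
      ((m₂ i).mul (mk _)) ?_
    have : Nontrivial E := Module.nontrivial_of_finrank_pos (R := ℝ) (by omega)
    filter_upwards [Measure.ae_ne (volume : Measure E) z₀] with z hz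
    rw [Real.norm_eq_abs, abs_mul]
    calc |V₂ i z| * |kernel m ξ z| ≤ (C * ‖z - z₀‖⁻¹) * ((m - 1) * invBracket z ^ m) := by
          gcongr
          · exact b₂ i z hz
          · exact k₀ z
      _ = _ := by ring
  have J1 : ∀ i, Integrable fun z => V z * kernelDeriv m ξ (b i) z * (1 + ‖z‖)⁻¹ := fun i => by
    refine integrable_of_abs_le_invBracket_pow hE (C := C * c₁) ((mV.mul (mk₁ _ _)).mul mw)
      fun z => ?_
    rw [abs_mul, abs_mul]
    have := hq z
    calc |V z| * |kernelDeriv m ξ (b i) z| * |(1 + ‖z‖)⁻¹|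
        ≤ |V z| * (c₁ * invBracket z ^ (m + 1)) * invBracket z := by
          gcongr
          · exact k₁ i z
          · exact hw z
      _ = (|V z| * invBracket z) * (c₁ * invBracket z ^ (m + 1)) := by ring
      _ ≤ C * (c₁ * invBracket z ^ (m + 1)) := by
          gcongr; exact bV z
      _ = _ := by ring
  have J0 : ∀ i, Integrable fun z => V₁ i z * kernel m ξ z * (1 + ‖z‖)⁻¹ := fun i => by
    refine integrable_of_abs_le_invBracket_pow hE (C := C * (m - 1)) (((m₁ i).mul (mk _)).mul mw)
      fun z => ?_
    rw [abs_mul, abs_mul]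
    have := hq z
    calc |V₁ i z| * |kernel m ξ z| * |(1 + ‖z‖)⁻¹|
        ≤ C * ((m - 1) * invBracket z ^ m) * invBracket z := by
          gcongr
          · exact b₁ i z
          · exact k₀ z
          · exact hw z
      _ = _ := by ring
  have key : ∀ i, ∫ z, V z * kernelDeriv₂ m ξ (b i) z = ∫ z, V₂ i z * kernel m ξ z := fun i => by
    rw [integral_mul_lineDeriv_eq_neg hE (d₁ i) (hasLineDerivAt_kernelDeriv m ξ (b i))
      (I2 i) (I1 i) (J1 i), integral_mul_lineDeriv_eq_neg hE (d₂ i)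
      (hasLineDerivAt_kernel m ξ (b i)) (I1 i) (I0 i) (J0 i), neg_neg]
  have hcard : Fintype.card ι = m := by rw [hm, Module.finrank_eq_card_basis b.toBasis]
  calc ∫ z, V z * kernelLaplacian m ξ z
      = ∫ z, ∑ i, V z * kernelDeriv₂ m ξ (b i) z := by
        congr 1; ext z
        rw [← sum_kernelDeriv₂ b hcard hξ z, Finset.mul_sum]
    _ = ∑ i, ∫ z, V z * kernelDeriv₂ m ξ (b i) z := integral_finsetSum _ fun i _ => I2 i
    _ = ∑ i, ∫ z, V₂ i z * kernel m ξ z := Finset.sum_congr rfl fun i _ => key i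
    _ = ∫ z, ∑ i, V₂ i z * kernel m ξ z := (integral_finsetSum _ fun i _ => I0 i).symm
    _ = _ := by
        congr 1; ext z
        rw [Finset.sum_mul]

theorem integrable_mul_kernelLaplacian (hE : 2 ≤ Module.finrank ℝ E) {ξ : E} (hξ : ‖ξ‖ = 1)
    {V : E → ℝ} (mV : AEStronglyMeasurable V) {C : ℝ}
    (bV : ∀ z, |V z| * invBracket z ^ 2 ≤ C) :
    Integrable fun z => V z * kernelLaplacian (Module.finrank ℝ E) ξ z := by
  set m := Module.finrank ℝ E with hm
  have hC : 0 ≤ C := le_trans (by have := invBracket_pos (0 : E); positivity) (bV 0)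
  set c : ℝ := m * (m + 2) * (m + 5) with hc
  have hc0 : 0 ≤ c := by positivity
  refine integrable_of_abs_le_invBracket_pow hE (C := C * c)
    (mV.mul (continuous_kernelLaplacian m ξ).aestronglyMeasurable) fun z => ?_
  rw [abs_mul]
  have h0 := invBracket_pos z
  calc |V z| * |kernelLaplacian m ξ z| ≤ |V z| * (c * invBracket z ^ (m + 4)) := by
        gcongr; exact abs_kernelLaplacian_le m hξ z
    _ = (|V z| * invBracket z ^ 2) * (c * (invBracket z ^ (m + 1) * invBracket z)) := by ring
    _ ≤ C * (c * (invBracket z ^ (m + 1) * 1)) := by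
        gcongr
        · exact bV z
        · exact invBracket_le_one z
    _ = _ := by ring

theorem abs_quadratic_mul_invBracket_sq_le (a : ℝ) (L : E →L[ℝ] ℝ) (B : E →L[ℝ] E →L[ℝ] ℝ)
    (z : E) : |a + L z + B z z / 2| * invBracket z ^ 2 ≤ |a| + ‖L‖ + ‖B‖ := by
  have h0 := invBracket_pos z
  have h1 := invBracket_le_one z
  have h2 := norm_mul_invBracket_le z
  have hL : |L z| ≤ ‖L‖ * ‖z‖ := L.le_opNorm z
  have hB : |B z z| ≤ ‖B‖ * ‖z‖ * ‖z‖ := B.le_opNorm₂ z z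
  have hq : invBracket z ^ 2 ≤ 1 := pow_le_one₀ h0.le h1
  calc |a + L z + B z z / 2| * invBracket z ^ 2
      ≤ (|a| + ‖L‖ * ‖z‖ + ‖B‖ * ‖z‖ * ‖z‖) * invBracket z ^ 2 := by
        gcongr
        refine (abs_add_le _ _).trans (add_le_add ((abs_add_le _ _).trans (by gcongr)) ?_)
        rw [abs_div, abs_two]
        linarith [abs_nonneg (B z z)]
    _ = |a| * invBracket z ^ 2 + ‖L‖ * ((‖z‖ * invBracket z) * invBracket z) +
        ‖B‖ * ((‖z‖ * invBracket z) * (‖z‖ * invBracket z)) := by ring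
    _ ≤ |a| * 1 + ‖L‖ * 1 + ‖B‖ * 1 := by
        gcongr
        · exact mul_le_one₀ h2 h0.le h1
        · exact mul_le_one₀ h2 (by positivity) h2
    _ = _ := by ring

/-- Two integrations by parts in direction `ξ` move both derivatives from `m q^(m+2)` to the
quadratic polynomial, leaving `B ξ ξ` times the mass. Thus the Taylor polynomial is reproduced
exactly, with no error in `ε`. -/
theorem integral_quadratic_mul_kernelLaplacian (hE : 2 ≤ Module.finrank ℝ E) {ξ : E}
    (hξ : ‖ξ‖ = 1) (a : ℝ) (L : E →L[ℝ] ℝ) (B : E →L[ℝ] E →L[ℝ] ℝ) :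
    ∫ z, (a + L z + B z z / 2) * kernelLaplacian (Module.finrank ℝ E) ξ z =
      B ξ ξ * (volume : Measure E).toSphere.real univ := by
  rw [← integral_invBracket_pow hE]
  set m := Module.finrank ℝ E with hm
  have hξ2 : ⟪ξ, ξ⟫ = 1 := by rw [real_inner_self_eq_norm_sq, hξ]; norm_num
  let ρ : E → ℝ := fun z => invBracket z ^ (m + 2)
  let ρ₁ : E → ℝ := fun z => -((m + 2 : ℕ) * invBracket z ^ (m + 2 + 2) * ⟪z, ξ⟫)
  let ρ₂ : E → ℝ := fun z => (m + 2) * (-invBracket z ^ (m + 4) +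
    (m + 4) * ⟪z, ξ⟫ ^ 2 * invBracket z ^ (m + 6))
  let Q₁ : E → ℝ := fun z => L ξ + (B z ξ + B ξ z) / 2
  have hc := continuous_invBracket (E := E)
  have dρ : ∀ z, HasLineDerivAt ℝ ρ (ρ₁ z) z ξ := fun z =>
    hasDerivAt_invBracket_pow_line (m + 2) z ξ
  have dρ₁ : ∀ z, HasLineDerivAt ℝ ρ₁ (ρ₂ z) z ξ := fun z => by
    have h := (((hasDerivAt_invBracket_pow_line (m + 2 + 2) z ξ).const_mul ((m + 2 : ℕ) : ℝ)).mul
      (hasDerivAt_inner_line z ξ ξ)).neg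
    refine h.congr_deriv ?_
    simp only [ρ₂, zero_smul, add_zero, hξ2]
    push_cast
    ring
  have dQ : ∀ z, HasLineDerivAt ℝ (fun z => a + L z + B z z / 2) (Q₁ z) z ξ := fun z => by
    simp only [div_eq_mul_inv]
    have h : HasFDerivAt (fun z => a + L z + B z z * 2⁻¹) _ z :=
      ((L.hasFDerivAt (x := z)).const_add a).add
      ((B.hasFDerivAt.clm_apply (hasFDerivAt_id z)).mul_const 2⁻¹)
    convert! h.hasLineDerivAt ξ using 1
    simp [Q₁]
    ring
  have dQ₁ : ∀ z, HasLineDerivAt ℝ Q₁ (B ξ ξ) z ξ := fun z => by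
    simp only [Q₁, div_eq_mul_inv]
    have h : HasFDerivAt (fun z => L ξ + (B z ξ + B ξ z) * 2⁻¹) _ z :=
      (((B.hasFDerivAt (x := z)).clm_apply
      (hasFDerivAt_const ξ z)).add (B ξ).hasFDerivAt |>.mul_const 2⁻¹).const_add (L ξ)
    convert! h.hasLineDerivAt ξ using 1
    simp
    ring
  have hq := fun z : E => (invBracket_pos z).le
  have hq1 := fun z : E => invBracket_le_one z
  have hw : ∀ z : E, |(1 + ‖z‖)⁻¹| ≤ invBracket z := fun z => by
    rw [abs_of_pos (by positivity)]; exact inv_one_add_norm_le_invBracket z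
  have hρ₁ : ∀ z, |ρ₁ z| ≤ (m + 2) * invBracket z ^ (m + 3) := fun z => by
    have h1 := abs_inner_mul_invBracket_le z ξ
    have := hq z
    rw [hξ] at h1
    simp only [ρ₁]
    rw [abs_neg, abs_mul, abs_of_nonneg (by positivity)]
    push_cast
    calc _ = (m + 2) * invBracket z ^ (m + 3) * (|⟪z, ξ⟫| * invBracket z) := by ring
      _ ≤ (m + 2) * invBracket z ^ (m + 3) * 1 := by gcongr
      _ = _ := mul_one _
  have hQ := abs_quadratic_mul_invBracket_sq_le a L B
  have hQ₁ : ∀ z, |Q₁ z| * invBracket z ≤ ‖L‖ + ‖B‖ := fun z => by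
    have h0 := hq z
    have hL : |L ξ| ≤ ‖L‖ := by simpa [hξ] using L.le_opNorm ξ
    have hB : |B z ξ| ≤ ‖B‖ * ‖z‖ := by simpa [hξ] using B.le_opNorm₂ z ξ
    have hB' : |B ξ z| ≤ ‖B‖ * ‖z‖ := by simpa [hξ] using B.le_opNorm₂ ξ z
    have h3 : |Q₁ z| ≤ ‖L‖ + ‖B‖ * ‖z‖ := by
      rw [abs_le] at *
      simp only [Q₁]
      constructor <;> linarith
    calc |Q₁ z| * invBracket z ≤ (‖L‖ + ‖B‖ * ‖z‖) * invBracket z := by gcongr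
      _ = ‖L‖ * invBracket z + ‖B‖ * (‖z‖ * invBracket z) := by ring
      _ ≤ ‖L‖ * 1 + ‖B‖ * 1 := by
          gcongr
          · exact hq1 z
          · exact norm_mul_invBracket_le z
      _ = _ := by ring
  set A := |a| + ‖L‖ + ‖B‖
  have hA : 0 ≤ A := by positivity
  have cQ : Continuous fun z => a + L z + B z z / 2 := by fun_prop
  have cQ₁ : Continuous Q₁ := by fun_prop
  have cρ : Continuous ρ := by fun_prop
  have cρ₁ : Continuous ρ₁ := by fun_prop
  have mw : AEStronglyMeasurable (fun z : E => (1 + ‖z‖)⁻¹) :=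
    (by fun_prop : Measurable fun z : E => (1 + ‖z‖)⁻¹).aestronglyMeasurable
  have e2 : ∀ z, (a + L z + B z z / 2) * kernelLaplacian m ξ z =
      m * ((a + L z + B z z / 2) * ρ₂ z) := fun z => by
    simp only [kernelLaplacian, ρ₂]; ring
  have hm0 : (m : ℝ) ≠ 0 := by have : m ≠ 0 := by omega
                               exact_mod_cast this
  have I2 : Integrable fun z => (a + L z + B z z / 2) * ρ₂ z := by
    have h := integrable_mul_kernelLaplacian hE hξ cQ.aestronglyMeasurable hQ
    simp only [← hm, e2] at h
    exact (integrable_const_mul_iff (IsUnit.mk0 _ hm0) _).1 h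
  have I1 : Integrable fun z => Q₁ z * ρ₁ z := by
    refine integrable_of_abs_le_invBracket_pow hE (C := (‖L‖ + ‖B‖) * (m + 2))
      (cQ₁.mul cρ₁).aestronglyMeasurable fun z => ?_
    have := hq z
    rw [abs_mul]
    calc |Q₁ z| * |ρ₁ z| ≤ |Q₁ z| * ((m + 2) * invBracket z ^ (m + 3)) := by
          gcongr; exact hρ₁ z
      _ = (|Q₁ z| * invBracket z) * ((m + 2) * (invBracket z ^ (m + 1) * invBracket z)) := by ring
      _ ≤ (‖L‖ + ‖B‖) * ((m + 2) * (invBracket z ^ (m + 1) * 1)) := by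
          gcongr
          · exact hQ₁ z
          · exact hq1 z
      _ = _ := by ring
  have I0 : Integrable fun z => B ξ ξ * ρ z := by
    refine Integrable.const_mul (integrable_of_abs_le_invBracket_pow hE (C := 1)
      cρ.aestronglyMeasurable fun z => ?_) _
    have := hq z
    rw [abs_of_nonneg (by positivity), one_mul]
    exact pow_le_pow_of_le_one this (hq1 z) (by omega)
  have J1 : Integrable fun z => (a + L z + B z z / 2) * ρ₁ z * (1 + ‖z‖)⁻¹ := by
    refine integrable_of_abs_le_invBracket_pow hE (C := A * (m + 2))
      ((cQ.mul cρ₁).aestronglyMeasurable.mul mw) fun z => ?_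
    have := hq z
    rw [abs_mul, abs_mul]
    calc _ ≤ |a + L z + B z z / 2| * ((m + 2) * invBracket z ^ (m + 3)) * invBracket z := by
          gcongr
          · exact hρ₁ z
          · exact hw z
      _ = (|a + L z + B z z / 2| * invBracket z ^ 2) *
          ((m + 2) * (invBracket z ^ (m + 1) * invBracket z)) := by ring
      _ ≤ A * ((m + 2) * (invBracket z ^ (m + 1) * 1)) := by
          gcongr
          · exact hQ z
          · exact hq1 z
      _ = _ := by ring
  have J0 : Integrable fun z => Q₁ z * ρ z * (1 + ‖z‖)⁻¹ := by
    refine integrable_of_abs_le_invBracket_pow hE (C := ‖L‖ + ‖B‖)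
      ((cQ₁.mul cρ).aestronglyMeasurable.mul mw) fun z => ?_
    have := hq z
    rw [abs_mul, abs_mul]
    calc _ ≤ |Q₁ z| * (invBracket z ^ (m + 2)) * invBracket z := by
          gcongr
          · exact (abs_of_nonneg (by positivity : 0 ≤ ρ z)).le
          · exact hw z
      _ = (|Q₁ z| * invBracket z) * (invBracket z ^ (m + 1) * invBracket z) := by ring
      _ ≤ (‖L‖ + ‖B‖) * (invBracket z ^ (m + 1) * 1) := by
          gcongr
          · exact hQ₁ z
          · exact hq1 z
      _ = _ := by ring
  simp only [e2]
  rw [integral_const_mul, integral_mul_lineDeriv_eq_neg (z₀ := 0) hE (fun z _ => dQ z) dρ₁ I2 I1 J1,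
    integral_mul_lineDeriv_eq_neg (z₀ := 0) hE (fun z _ => dQ₁ z) dρ I1 I0 J0, neg_neg,
    integral_const_mul]
  ring

open Asymptotics in
/-- The regularized second derivatives converge at a point with a second order expansion. -/
theorem tendsto_integral_mul_kernelLaplacian (hE : 2 ≤ Module.finrank ℝ E) {ξ : E}
    (hξ : ‖ξ‖ = 1) {U : E → ℝ} (mU : Measurable U) {C : ℝ} (bU : ∀ y, |U y| ≤ C * ‖y‖) {e : E}
    {L : E →L[ℝ] ℝ} {B : E →L[ℝ] E →L[ℝ] ℝ}
    (hT : (fun h => U (e + h) - (U e + L h + B h h / 2)) =o[𝓝 0] fun h => ‖h‖ ^ 2) :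
    Tendsto (fun ε : ℝ => (ε ^ 2)⁻¹ *
        ∫ z, U (e + ε • z) * kernelLaplacian (Module.finrank ℝ E) ξ z) (𝓝[>] 0)
      (𝓝 (B ξ ξ * (volume : Measure E).toSphere.real univ)) := by
  set m := Module.finrank ℝ E with hm
  set R : E → ℝ := fun h => U (e + h) - (U e + L h + B h h / 2) with hR
  have : Nontrivial E := Module.nontrivial_of_finrank_pos (R := ℝ) (by omega)
  have hC : 0 ≤ C := by
    obtain ⟨y, hy⟩ := exists_ne (0 : E)
    by_contra! h
    have h1 := bU y
    nlinarith [abs_nonneg (U y), norm_pos_iff.2 hy]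
  -- The Taylor remainder is globally quadratic: near 0 by the Peano estimate, and for `‖h‖ ≥ δ`
  -- because `U` grows linearly and powers of `‖h‖ / δ ≥ 1` may be inserted. This supplies the
  -- dominating function `D ‖z‖² |kernelLaplacian|`.
  obtain ⟨D, hD0, hD⟩ : ∃ D, 0 ≤ D ∧ ∀ h, |R h| ≤ D * ‖h‖ ^ 2 := by
    have h1 := hT.def one_pos
    obtain ⟨δ, hδ, hball⟩ := Metric.eventually_nhds_iff_ball.1 h1
    refine ⟨1 + (C * ‖e‖ + |U e|) / δ ^ 2 + (C + ‖L‖) / δ + ‖B‖, by positivity, fun h => ?_⟩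
    by_cases hh : ‖h‖ < δ
    · have h2 := hball h (by simpa using hh)
      simp only [norm_pow, one_mul, Real.norm_eq_abs] at h2
      refine h2.trans ?_
      rw [abs_of_nonneg (norm_nonneg h)]
      have : 0 ≤ (C * ‖e‖ + |U e|) / δ ^ 2 + (C + ‖L‖) / δ + ‖B‖ := by positivity
      nlinarith [sq_nonneg ‖h‖]
    · push Not at hh
      have hL : |L h| ≤ ‖L‖ * ‖h‖ := L.le_opNorm h
      have hB : |B h h| ≤ ‖B‖ * ‖h‖ * ‖h‖ := B.le_opNorm₂ h h
      have hU : |U (e + h)| ≤ C * ‖e‖ + C * ‖h‖ := by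
        rw [← mul_add]
        exact (bU _).trans (by gcongr; exact norm_add_le _ _)
      have h3 : |R h| ≤ (C * ‖e‖ + |U e|) + (C + ‖L‖) * ‖h‖ + ‖B‖ * ‖h‖ ^ 2 := by
        simp only [hR]
        have hUe := abs_le.1 (le_refl |U e|)
        have : 0 ≤ ‖B‖ * ‖h‖ * ‖h‖ := by positivity
        rw [abs_le] at *
        constructor <;> nlinarith
      have h4 : 1 ≤ ‖h‖ / δ := by rwa [one_le_div hδ]
      have h5 : 1 ≤ (‖h‖ / δ) ^ 2 := one_le_pow₀ h4
      have a1 : (C * ‖e‖ + |U e|) ≤ (C * ‖e‖ + |U e|) * (‖h‖ / δ) ^ 2 :=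
        le_mul_of_one_le_right (by positivity) h5
      have a2 : (C + ‖L‖) * ‖h‖ ≤ (C + ‖L‖) * ‖h‖ * (‖h‖ / δ) :=
        le_mul_of_one_le_right (by positivity) h4
      calc |R h| ≤ _ := h3
        _ ≤ (C * ‖e‖ + |U e|) * (‖h‖ / δ) ^ 2 + (C + ‖L‖) * ‖h‖ * (‖h‖ / δ) + ‖B‖ * ‖h‖ ^ 2 := by
            linarith
        _ = ((C * ‖e‖ + |U e|) / δ ^ 2 + (C + ‖L‖) / δ + ‖B‖) * ‖h‖ ^ 2 := by
            rw [div_pow]; ring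
        _ ≤ _ := by nlinarith [sq_nonneg ‖h‖]
  have mR : Measurable R := by
    have : Measurable fun h => U (e + h) := mU.comp (measurable_const_add e)
    have c : Continuous fun h => U e + L h + B h h / 2 := by fun_prop
    exact this.sub c.measurable
  have hz : ∀ z : E, ‖z‖ ^ 2 * invBracket z ^ 2 ≤ 1 := fun z => by
    have := invBracket_sq_mul z
    nlinarith [sq_nonneg (invBracket z)]
  have iR : ∀ ε : ℝ, Integrable fun z => R (ε • z) * kernelLaplacian m ξ z := fun ε => by
    refine integrable_mul_kernelLaplacian hE hξ (C := D * ε ^ 2)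
      (mR.comp (measurable_const_smul ε)).aestronglyMeasurable fun z => ?_
    calc |R (ε • z)| * invBracket z ^ 2 ≤ D * ‖ε • z‖ ^ 2 * invBracket z ^ 2 := by
          gcongr; exact hD _
      _ = D * ε ^ 2 * (‖z‖ ^ 2 * invBracket z ^ 2) := by
          rw [norm_smul, mul_pow, Real.norm_eq_abs, sq_abs]; ring
      _ ≤ D * ε ^ 2 * 1 := by gcongr; exact hz z
      _ = _ := mul_one _
  have hlim : Tendsto (fun ε : ℝ => ∫ z, (ε ^ 2)⁻¹ * (R (ε • z) * kernelLaplacian m ξ z))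
      (𝓝[>] 0) (𝓝 (∫ _ : E, (0 : ℝ))) := by
    have iB : Integrable fun z : E => (D * ‖z‖ ^ 2) * kernelLaplacian m ξ z := by
      refine integrable_mul_kernelLaplacian hE hξ (C := D)
        (by fun_prop : Continuous _).aestronglyMeasurable fun z => ?_
      rw [abs_of_nonneg (by positivity)]
      nlinarith [hz z]
    refine tendsto_integral_filter_of_dominated_convergence _
      (Eventually.of_forall fun ε => ((iR ε).const_mul _).1) ?_ iB.abs (ae_of_all _ fun z => ?_)
    · filter_upwards [self_mem_nhdsWithin] with ε hε
      have hε : (0 : ℝ) < ε := hε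
      refine ae_of_all _ fun z => ?_
      rw [Real.norm_eq_abs, abs_mul, abs_mul, abs_mul, abs_of_pos (by positivity),
        abs_of_nonneg (by positivity : 0 ≤ D * ‖z‖ ^ 2), ← mul_assoc]
      refine mul_le_mul_of_nonneg_right ?_ (abs_nonneg _)
      rw [inv_mul_le_iff₀ (by positivity)]
      calc |R (ε • z)| ≤ D * ‖ε • z‖ ^ 2 := hD _
        _ = _ := by rw [norm_smul, mul_pow, Real.norm_eq_abs, sq_abs]; ring
    · have h1 : Tendsto (fun ε : ℝ => ε • z) (𝓝[>] 0) (𝓝 0) := by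
        have : Continuous fun ε : ℝ => ε • z := by fun_prop
        have h := (this.tendsto 0).mono_left (nhdsWithin_le_nhds (s := Ioi 0))
        simpa using h
      have h2 : (fun ε : ℝ => R (ε • z)) =o[𝓝[>] 0] fun ε : ℝ => ε ^ 2 := by
        refine (hT.comp_tendsto h1).trans_isBigO ?_
        refine IsBigO.of_bound (‖z‖ ^ 2) (Eventually.of_forall fun ε => ?_)
        simp only [Function.comp, norm_smul, norm_pow, norm_mul, norm_norm]
        rw [mul_pow, mul_comm]
      have h3 := h2.tendsto_div_nhds_zero.mul_const (kernelLaplacian m ξ z)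
      rw [zero_mul] at h3
      refine h3.congr fun ε => ?_
      ring
  have hfin := hlim.const_add (B ξ ξ * (volume : Measure E).toSphere.real univ)
  simp only [integral_zero, add_zero] at hfin
  refine hfin.congr' ?_
  filter_upwards [self_mem_nhdsWithin] with ε hε
  have hε : (0 : ℝ) < ε := hε
  have e2 := integral_quadratic_mul_kernelLaplacian hE hξ (U e) (ε • L) (ε ^ 2 • B)
  have i2 := integrable_mul_kernelLaplacian hE hξ
    (V := fun z => U e + (ε • L) z + (ε ^ 2 • B) z z / 2)
    (by fun_prop : Continuous _).aestronglyMeasurable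
    (abs_quadratic_mul_invBracket_sq_le (U e) (ε • L) (ε ^ 2 • B))
  rw [integral_const_mul]
  have e3 : ∫ z, U (e + ε • z) * kernelLaplacian m ξ z =
      ∫ z, ((U e + (ε • L) z + (ε ^ 2 • B) z z / 2) * kernelLaplacian m ξ z +
        R (ε • z) * kernelLaplacian m ξ z) := by
    congr 1; ext z
    simp only [hR, map_smul, smul_apply, smul_eq_mul]
    ring
  rw [e3, integral_add i2 (iR ε), e2, mul_add]
  congr 1
  simp only [smul_apply, smul_eq_mul]
  field_simp

/-- The pointwise bound for second derivatives by the Newton potential of the Laplacian. -/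
theorem abs_second_deriv_mul_le (hE : 2 ≤ Module.finrank ℝ E) {ι : Type*} [Fintype ι]
    (b : OrthonormalBasis ι ℝ E) {ξ : E} (hξ : ‖ξ‖ = 1) {C : ℝ} {U : E → ℝ}
    {U₁ U₂ : ι → E → ℝ} (mU : Measurable U)
    (m₁ : ∀ i, Measurable (U₁ i)) (m₂ : ∀ i, Measurable (U₂ i))
    (bU : ∀ y, |U y| ≤ C * ‖y‖) (b₁ : ∀ i y, |U₁ i y| ≤ C)
    (b₂ : ∀ i y, y ≠ 0 → |U₂ i y| ≤ C * ‖y‖⁻¹)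
    (d₁ : ∀ i y, y ≠ 0 → HasLineDerivAt ℝ U (U₁ i y) y (b i))
    (d₂ : ∀ i y, y ≠ 0 → HasLineDerivAt ℝ (U₁ i) (U₂ i y) y (b i)) {e : E}
    {L : E →L[ℝ] ℝ} {B : E →L[ℝ] E →L[ℝ] ℝ}
    (hT : (fun h => U (e + h) - (U e + L h + B h h / 2)) =o[𝓝 0] fun h => ‖h‖ ^ 2)
    {K : E → ℝ} (iK : Integrable K)
    (hK : ∀ y, y ≠ 0 → |∑ i, U₂ i y| * (‖y - e‖ ^ Module.finrank ℝ E)⁻¹ ≤ K y) :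
    |B ξ ξ| * (volume : Measure E).toSphere.real univ ≤ (Module.finrank ℝ E - 1) * ∫ y, K y := by
  have hlim := (tendsto_integral_mul_kernelLaplacian hE hξ mU bU hT).abs
  rw [abs_mul, abs_of_nonneg (measureReal_nonneg (s := univ))] at hlim
  set m := Module.finrank ℝ E with hm
  have : Nontrivial E := Module.nontrivial_of_finrank_pos (R := ℝ) (by omega)
  have hC : 0 ≤ C := by
    obtain ⟨y, hy⟩ := exists_ne (0 : E)
    by_contra! h
    have h1 := bU y
    nlinarith [abs_nonneg (U y), norm_pos_iff.2 hy]
  have hm1 : (0 : ℝ) ≤ m - 1 := by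
    have : (2 : ℝ) ≤ m := by exact_mod_cast hE
    linarith
  refine le_of_tendsto hlim ?_
  filter_upwards [self_mem_nhdsWithin] with ε hε
  have hε : (0 : ℝ) < ε := hε
  have hne : ∀ z, z ≠ -(ε⁻¹ • e) → e + ε • z ≠ 0 := fun z hz h => hz <| by
    rw [eq_neg_iff_add_eq_zero, ← smul_right_injective E hε.ne' |>.eq_iff]
    simp only [smul_add, smul_smul, mul_inv_cancel₀ hε.ne', one_smul, smul_zero]
    rw [add_comm]; exact h
  have maff : Measurable fun z : E => e + ε • z := by fun_prop
  have daff : ∀ (F : E → ℝ) (F' : ℝ) (z v : E), HasLineDerivAt ℝ F F' (e + ε • z) v →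
      HasLineDerivAt ℝ (fun z => F (e + ε • z)) (ε * F') z v := by
    intro F F' z v h
    have h1 : HasDerivAt (fun t : ℝ => ε * t) ε 0 := by
      simpa using (hasDerivAt_id (0 : ℝ)).const_mul ε
    have h2 : HasDerivAt (fun t : ℝ => F (e + ε • z + t • v)) F' (ε * 0) := by
      rw [mul_zero]; exact h
    have h3 := h2.comp 0 h1
    rw [mul_comm] at h3
    unfold HasLineDerivAt
    convert! h3 using 1
    ext t
    simp only [Function.comp, smul_add, smul_smul, add_assoc]
  -- The rescaled function `z ↦ U (e + ε z)` has its singularity at `-e/ε`. The constant passed as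
  -- `C` may depend on `ε`, as it serves only integrability.
  have hgreen := integral_mul_kernelLaplacian hE b hξ (z₀ := -(ε⁻¹ • e))
    (C := C * (1 + ‖e‖ + ε))
    (V := fun z => U (e + ε • z)) (V₁ := fun i z => ε * U₁ i (e + ε • z))
    (V₂ := fun i z => ε * (ε * U₂ i (e + ε • z)))
    (mU.comp maff).aestronglyMeasurable
    (fun i => (((m₁ i).comp maff).const_mul ε).aestronglyMeasurable)
    (fun i => ((((m₂ i).comp maff).const_mul ε).const_mul ε).aestronglyMeasurable)
    (fun z => by
      have h0 := invBracket_pos z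
      calc |U (e + ε • z)| * invBracket z ≤ C * (‖e‖ + ε * ‖z‖) * invBracket z := by
            gcongr
            refine (bU _).trans ?_
            gcongr
            refine (norm_add_le _ _).trans ?_
            rw [norm_smul, Real.norm_eq_abs, abs_of_pos hε]
        _ = C * (‖e‖ * invBracket z + ε * (‖z‖ * invBracket z)) := by ring
        _ ≤ C * (‖e‖ * 1 + ε * 1) := by
            gcongr
            · exact invBracket_le_one z
            · exact norm_mul_invBracket_le z
        _ ≤ _ := by nlinarith)
    (fun i z => by
      rw [abs_mul, abs_of_pos hε]
      have := b₁ i (e + ε • z)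
      nlinarith [norm_nonneg e, mul_nonneg hC (norm_nonneg e)])
    (fun i z hz => by
      have h1 := b₂ i _ (hne z hz)
      have h2 : e + ε • z = ε • (z - -(ε⁻¹ • e)) := by
        rw [sub_neg_eq_add, smul_add, smul_smul, mul_inv_cancel₀ hε.ne', one_smul, add_comm]
      have h3 : ‖e + ε • z‖⁻¹ = ε⁻¹ * ‖z - -(ε⁻¹ • e)‖⁻¹ := by
        rw [h2, norm_smul, Real.norm_eq_abs, abs_of_pos hε, mul_inv]
      rw [h3] at h1
      rw [abs_mul, abs_mul, abs_of_pos hε]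
      calc ε * (ε * |U₂ i (e + ε • z)|) ≤
            ε * (ε * (C * (ε⁻¹ * ‖z - -(ε⁻¹ • e)‖⁻¹))) := by gcongr
        _ = C * ε * ‖z - -(ε⁻¹ • e)‖⁻¹ := by field_simp
        _ ≤ _ := by
            gcongr
            linarith [norm_nonneg e])
    (fun i z hz => daff _ _ _ _ (d₁ i _ (hne z hz)))
    (fun i z hz => by
      have := (daff _ _ _ _ (d₂ i _ (hne z hz)))
      exact HasDerivAt.const_mul ε this)
  rw [hgreen]
  have hcv : ∫ z, K (e + ε • z) = (ε ^ m)⁻¹ * ∫ y, K y := by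
    rw [Measure.integral_comp_smul volume (fun z => K (e + z)) ε, integral_add_left_eq_self K e,
      abs_of_pos (by positivity), smul_eq_mul]
  have iK' : Integrable fun z => K (e + ε • z) :=
    (iK.comp_add_left e).comp_smul hε.ne'
  -- All powers of `ε` cancel: `ε²` from the two derivatives against the normalization `(ε²)⁻¹`, and
  -- `ε^m` from the homogeneity of `‖z‖^(-m)` against the Jacobian. The bound is therefore uniform
  -- in `ε` and survives the limit.
  have hbound : ‖∫ z, (∑ i, ε * (ε * U₂ i (e + ε • z))) * kernel m ξ z‖ ≤
      ∫ z, ε ^ 2 * (m - 1) * ε ^ m * K (e + ε • z) := by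
    refine norm_integral_le_of_norm_le (iK'.const_mul _) ?_
    filter_upwards [Measure.ae_ne (volume : Measure E) (-(ε⁻¹ • e)),
      Measure.ae_ne (volume : Measure E) 0] with z hz hz0
    have h1 := hK _ (hne z hz)
    have hz' : 0 < ‖z‖ := norm_pos_iff.2 hz0
    have p1 := invBracket_pos z
    have h2 : invBracket z ^ m ≤ (‖z‖ ^ m)⁻¹ := by
      rw [← inv_pow]
      gcongr
      rw [← one_div, le_div_iff₀ hz', mul_comm]
      exact norm_mul_invBracket_le z
    rw [add_sub_cancel_left, norm_smul, Real.norm_eq_abs, abs_of_pos hε, mul_pow, mul_inv] at h1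
    have h3 : ∑ i, ε * (ε * U₂ i (e + ε • z)) = ε ^ 2 * ∑ i, U₂ i (e + ε • z) := by
      rw [Finset.mul_sum]
      exact Finset.sum_congr rfl fun i _ => by ring
    rw [h3, Real.norm_eq_abs, abs_mul, abs_mul, abs_of_pos (by positivity)]
    calc ε ^ 2 * |∑ i, U₂ i (e + ε • z)| * |kernel m ξ z|
        ≤ ε ^ 2 * |∑ i, U₂ i (e + ε • z)| * ((m - 1) * (‖z‖ ^ m)⁻¹) := by
          gcongr
          exact (abs_kernel_le hE hξ z).trans (by gcongr)
      _ = ε ^ 2 * (m - 1) * ε ^ m *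
          (|∑ i, U₂ i (e + ε • z)| * ((ε ^ m)⁻¹ * (‖z‖ ^ m)⁻¹)) := by
          field_simp
      _ ≤ _ := by gcongr
  rw [integral_const_mul, hcv, Real.norm_eq_abs] at hbound
  rw [abs_mul, abs_of_pos (by positivity), inv_mul_le_iff₀ (by positivity)]
  refine hbound.trans_eq ?_
  field_simp

end Representation

/-! ### Second order expansion. -/

section Taylor

variable {E : Type*} [NormedAddCommGroup E] [NormedSpace ℝ E]

open Asymptotics in
/-- The second order Taylor expansion with Peano remainder. -/
theorem isLittleO_taylor_two {f : E → ℝ} {x : E} (hf : ContDiffAt ℝ 2 f x) :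
    (fun h => f (x + h) - (f x + fderiv ℝ f x h + fderiv ℝ (fderiv ℝ f) x h h / 2)) =o[𝓝 0]
      fun h => ‖h‖ ^ 2 := by
  set L := fderiv ℝ f x
  set B := fderiv ℝ (fderiv ℝ f) x with hB
  have hsymm : ∀ v w, B v w = B w v := fun v w =>
    (hf.isSymmSndFDerivAt (by simp)) v w
  have hdiff : DifferentiableAt ℝ (fderiv ℝ f) x :=
    (hf.fderiv_right (m := 1) (by norm_num)).differentiableAt (by norm_num)
  have hd2 := hdiff.hasFDerivAt
  rw [hasFDerivAt_iff_isLittleO_nhds_zero] at hd2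
  have hd1 : ∀ᶠ y in 𝓝 x, DifferentiableAt ℝ f y :=
    (hf.eventually (by simp)).mono fun y hy => hy.differentiableAt (by norm_num)
  refine IsLittleO.of_bound fun c hc => ?_
  have h1 := hd2.def hc
  have h2 : ∀ᶠ h in 𝓝 (0 : E), DifferentiableAt ℝ f (x + h) := by
    have : Tendsto (fun h : E => x + h) (𝓝 0) (𝓝 x) := by
      simpa using (continuous_const_add x).tendsto 0
    exact this.eventually hd1
  obtain ⟨δ, hδ, hball⟩ := Metric.eventually_nhds_iff_ball.1 (h1.and h2)
  refine Metric.eventually_nhds_iff_ball.2 ⟨δ, hδ, fun h hh => ?_⟩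
  have hsub : Metric.closedBall (0 : E) ‖h‖ ⊆ Metric.ball 0 δ :=
    Metric.closedBall_subset_ball (by simpa using hh)
  -- Symmetry of the second derivative makes the derivative of the remainder equal to the first
  -- order error of `fderiv ℝ f`, which is `o(‖k‖)`; the mean value inequality on the ball of radius
  -- `‖h‖` then gains one more power.
  have hder : ∀ k ∈ Metric.closedBall (0 : E) ‖h‖, HasFDerivWithinAt
      (fun h => f (x + h) - (f x + L h + B h h * 2⁻¹)) (fderiv ℝ f (x + k) - L - B k)
      (Metric.closedBall 0 ‖h‖) k := by
    intro k hk
    have hfk := (hball k (hsub hk)).2.hasFDerivAt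
    have e1 : HasFDerivAt (fun h => f (x + h)) (fderiv ℝ f (x + k)) k := by
      have e0 : HasFDerivAt (fun h : E => x + h) (ContinuousLinearMap.id ℝ E) k :=
        (hasFDerivAt_id k).const_add x
      exact hfk.comp k e0
    have e2 : HasFDerivAt (fun h => f x + L h + B h h * 2⁻¹) _ k :=
      ((L.hasFDerivAt (x := k)).const_add (f x)).add
      ((B.hasFDerivAt.clm_apply (hasFDerivAt_id k)).mul_const 2⁻¹)
    refine ((e1.sub e2).congr_fderiv ?_).hasFDerivWithinAt
    ext v
    simp [hsymm v k]
    ring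
  have hbd : ∀ k ∈ Metric.closedBall (0 : E) ‖h‖, ‖fderiv ℝ f (x + k) - L - B k‖ ≤ c * ‖h‖ := by
    intro k hk
    refine (hball k (hsub hk)).1.trans ?_
    have : ‖k‖ ≤ ‖h‖ := by simpa using hk
    gcongr
  have := (convex_closedBall (0 : E) ‖h‖).norm_image_sub_le_of_norm_hasFDerivWithin_le hder hbd
    (Metric.mem_closedBall_self (norm_nonneg h)) (by simp : h ∈ Metric.closedBall 0 ‖h‖)
  simp only [add_zero, map_zero, zero_mul, sub_self, sub_zero] at this
  simp only [div_eq_mul_inv]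
  rw [norm_pow, norm_norm]
  calc _ ≤ c * ‖h‖ * ‖h‖ := this
    _ = _ := by ring

theorem HasFDerivAt.hasDerivAt_line {F : Type*} [NormedAddCommGroup F] [NormedSpace ℝ F]
    {f : E → F} {f' : E →L[ℝ] F} {x : E} (h : HasFDerivAt f f' x) (v : E) :
    HasDerivAt (fun t : ℝ => f (x + t • v)) (f' v) 0 := h.hasLineDerivAt v

theorem norm_smul_clm {F : Type*} [NormedAddCommGroup F] [NormedSpace ℝ F] (c : ℝ)
    (B : E →L[ℝ] F) : ‖c • B‖ = |c| * ‖B‖ :=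
  norm_smul c B

end Taylor

/-! ### Homogeneous extensions and the equation they satisfy. -/

section HomogeneousExtension

variable {n : ℕ}

theorem homExt_of_ne (k : ℕ) (u : Sph n → ℝ) {y : Space n} (hy : y ≠ 0) :
    homExt k u y = ‖y‖ ^ k * u ⟨‖y‖⁻¹ • y, normalize_mem hy⟩ := by
  simp [homExt, hy]

theorem coe_sph_ne_zero (x : Sph n) : (x : Space n) ≠ 0 := ne_zero_of_mem_unit_sphere x

theorem homExt_coe (k : ℕ) (u : Sph n → ℝ) (x : Sph n) : homExt k u (x : Space n) = u x := by
  rw [homExt_of_ne k u (coe_sph_ne_zero x)]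
  have h : ‖(x : Space n)‖ = 1 := by simp
  have : (⟨‖(x : Space n)‖⁻¹ • (x : Space n), normalize_mem (coe_sph_ne_zero x)⟩ : Sph n) = x := by
    ext1; simp
  rw [this, h]; simp

theorem homExt_one_eq (u : Sph n → ℝ) (y : Space n) :
    homExt 1 u y = ‖y‖ * homExt 0 u y := by
  by_cases hy : y = 0
  · simp [homExt, hy]
  · rw [homExt_of_ne 1 u hy, homExt_of_ne 0 u hy]; simp

theorem homExt_zero_smul (u : Sph n → ℝ) {t : ℝ} (ht : 0 < t) (y : Space n) :
    homExt 0 u (t • y) = homExt 0 u y := by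
  by_cases hy : y = 0
  · simp [hy]
  · rw [homExt_of_ne 0 u hy, homExt_of_ne 0 u (smul_ne_zero ht.ne' hy)]
    rw [pow_zero, pow_zero, one_mul, one_mul]
    congr 1
    ext1
    simp only [norm_smul, Real.norm_eq_abs, abs_of_pos ht, mul_inv, smul_smul]
    congr 1
    field_simp

theorem homExt_one_smul (u : Sph n → ℝ) {t : ℝ} (ht : 0 < t) (y : Space n) :
    homExt 1 u (t • y) = t * homExt 1 u y := by
  rw [homExt_one_eq, homExt_one_eq, homExt_zero_smul u ht, norm_smul, Real.norm_eq_abs,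
    abs_of_pos ht, mul_assoc]

/-- Smoothness of maps into the sphere is available for globally defined maps, so `y ↦ y/|y|` is
first modified far from the point: `p` is the identity near `y` and stays within `‖y‖ / 2` of `y`,
hence avoids the origin. -/
theorem contDiffAt_homExt_zero {u : Sph n → ℝ} (hu : ContMDiff (𝓡 n) 𝓘(ℝ, ℝ) 2 u)
    {y : Space n} (hy : y ≠ 0) : ContDiffAt ℝ 2 (homExt 0 u) y := by
  have hy' : 0 < ‖y‖ := norm_pos_iff.2 hy
  let χ : ContDiffBump y := ⟨‖y‖ / 4, ‖y‖ / 2, by positivity, by linarith⟩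
  let p : Space n → Space n := fun z => y + χ z • (z - y)
  have hp : ContDiff ℝ 2 p :=
    contDiff_const.add (χ.contDiff.smul (contDiff_id.sub contDiff_const))
  have hp0 : ∀ z, p z ≠ 0 := by
    intro z hz
    have h1 : ‖χ z • (z - y)‖ = ‖y‖ := by
      have : χ z • (z - y) = -y := by
        rw [eq_neg_iff_add_eq_zero, add_comm]; exact hz
      rw [this, norm_neg]
    rw [norm_smul, Real.norm_eq_abs, abs_of_nonneg χ.nonneg] at h1
    by_cases hzb : dist z y < ‖y‖ / 2
    · rw [dist_eq_norm] at hzb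
      nlinarith [χ.le_one (x := z), χ.nonneg (x := z), norm_nonneg (z - y)]
    · have : χ z = 0 := χ.zero_of_le_dist (not_lt.1 hzb)
      rw [this, zero_mul] at h1
      linarith
  let P : Space n → Space n := fun z => ‖p z‖⁻¹ • p z
  have hP : ContDiff ℝ 2 P :=
    ((hp.norm ℝ hp0).inv fun z => norm_ne_zero_iff.2 (hp0 z)).smul hp
  have hPm : ∀ z, P z ∈ Metric.sphere (0 : Space n) 1 := fun z => normalize_mem (hp0 z)
  have := Fact.mk (@finrank_euclideanSpace_fin ℝ _ (n + 1))
  have hcod := hP.contMDiff.codRestrict_sphere (n := n) hPm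
  have hcomp : ContDiff ℝ 2 (fun z => u (Set.codRestrict P _ hPm z)) :=
    (hu.comp hcod).contDiff
  refine hcomp.contDiffAt.congr_of_eventuallyEq ?_
  have hev : ∀ᶠ z in 𝓝 y, χ z = 1 := χ.eventuallyEq_one
  filter_upwards [hev, isOpen_ne.mem_nhds hy] with z hz hz0
  have hpz : p z = z := by simp [p, hz]
  rw [homExt_of_ne 0 u hz0, pow_zero, one_mul]
  congr 1
  ext1
  simp [P, hpz]

theorem contDiffAt_homExt_one {u : Sph n → ℝ} (hu : ContMDiff (𝓡 n) 𝓘(ℝ, ℝ) 2 u)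
    {y : Space n} (hy : y ≠ 0) : ContDiffAt ℝ 2 (homExt 1 u) y := by
  have : homExt 1 u = fun y => ‖y‖ * homExt 0 u y := funext (homExt_one_eq u)
  rw [this]
  exact (contDiffAt_id.norm ℝ hy).mul (contDiffAt_homExt_zero hu hy)

theorem differentiableAt_fderiv_of_contDiffAt_two {f : Space n → ℝ} {y : Space n}
    (h : ContDiffAt ℝ 2 f y) : DifferentiableAt ℝ (fderiv ℝ f) y :=
  (h.fderiv_right (m := 1) (by norm_num)).differentiableAt (by norm_num)

theorem hasDerivAt_norm_line {y : Space n} (hy : y ≠ 0) (v : Space n) :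
    HasDerivAt (fun t : ℝ => ‖y + t • v‖) (‖y‖⁻¹ * ⟪y, v⟫) 0 := by
  have hy' : 0 < ‖y‖ := norm_pos_iff.2 hy
  have h := (hasDerivAt_norm_sq_line y v).sqrt (by simpa using hy)
  simp only [Real.sqrt_sq (norm_nonneg _)] at h
  refine h.congr_deriv ?_
  simp only [zero_smul, add_zero]
  field_simp

theorem fderiv_homExt_zero_self {u : Sph n → ℝ} (hu : ContMDiff (𝓡 n) 𝓘(ℝ, ℝ) 2 u)
    {y : Space n} (hy : y ≠ 0) : fderiv ℝ (homExt 0 u) y y = 0 := by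
  have h := HasFDerivAt.hasDerivAt_line
    ((contDiffAt_homExt_zero hu hy).differentiableAt (by norm_num)).hasFDerivAt y
  have h2 : HasDerivAt (fun t : ℝ => homExt 0 u (y + t • y)) 0 0 := by
    refine (hasDerivAt_const (0 : ℝ) (homExt 0 u y)).congr_of_eventuallyEq ?_
    filter_upwards [lt_mem_nhds (show (-1 : ℝ) < 0 by norm_num)] with t ht
    have : y + t • y = (1 + t) • y := by rw [add_smul, one_smul]
    rw [this, homExt_zero_smul u (by linarith)]
  exact h.unique h2

theorem fderiv_homExt_one_apply {u : Sph n → ℝ} (hu : ContMDiff (𝓡 n) 𝓘(ℝ, ℝ) 2 u)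
    {y : Space n} (hy : y ≠ 0) (v : Space n) :
    fderiv ℝ (homExt 1 u) y v =
      ‖y‖ * fderiv ℝ (homExt 0 u) y v + homExt 0 u y * (‖y‖⁻¹ * ⟪y, v⟫) := by
  have h1 := HasFDerivAt.hasDerivAt_line
    ((contDiffAt_homExt_one hu hy).differentiableAt (by norm_num)).hasFDerivAt v
  have h0 := HasFDerivAt.hasDerivAt_line
    ((contDiffAt_homExt_zero hu hy).differentiableAt (by norm_num)).hasFDerivAt v
  have h2 := (hasDerivAt_norm_line hy v).mul h0
  have e : (fun t : ℝ => homExt 1 u (y + t • v)) =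
      (fun t : ℝ => ‖y + t • v‖) * fun t : ℝ => homExt 0 u (y + t • v) := by
    ext t; exact homExt_one_eq u _
  rw [e] at h1
  rw [h1.unique h2]
  simp only [zero_smul, add_zero]
  ring

theorem fderiv_fderiv_homExt_one_apply {u : Sph n → ℝ} (hu : ContMDiff (𝓡 n) 𝓘(ℝ, ℝ) 2 u)
    (x : Sph n) (v : Space n) :
    fderiv ℝ (fderiv ℝ (homExt 1 u)) (x : Space n) v v =
      fderiv ℝ (fderiv ℝ (homExt 0 u)) (x : Space n) v v +
        2 * (⟪(x : Space n), v⟫ * fderiv ℝ (homExt 0 u) x v) +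
        u x * (⟪v, v⟫ - ⟪(x : Space n), v⟫ ^ 2) := by
  have hx := coe_sph_ne_zero x
  have hx1 : ‖(x : Space n)‖ = 1 := by simp
  have D1 := HasFDerivAt.hasDerivAt_line (differentiableAt_fderiv_of_contDiffAt_two
    (contDiffAt_homExt_one hu hx)).hasFDerivAt v
  have D0 := HasFDerivAt.hasDerivAt_line (differentiableAt_fderiv_of_contDiffAt_two
    (contDiffAt_homExt_zero hu hx)).hasFDerivAt v
  have E1 := D1.clm_apply (hasDerivAt_const (0 : ℝ) v)
  have E0 := D0.clm_apply (hasDerivAt_const (0 : ℝ) v)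
  have W := HasFDerivAt.hasDerivAt_line
    ((contDiffAt_homExt_zero hu hx).differentiableAt (by norm_num)).hasFDerivAt v
  have N := hasDerivAt_norm_line hx v
  have I := hasDerivAt_inner_line (x : Space n) v v
  have T := (N.mul E0).add (W.mul ((N.inv (by simp)).mul I))
  have hev : (fun t : ℝ => fderiv ℝ (homExt 1 u) ((x : Space n) + t • v) v) =ᶠ[𝓝 0]
      fun t : ℝ => ‖(x : Space n) + t • v‖ * fderiv ℝ (homExt 0 u) ((x : Space n) + t • v) v +
        homExt 0 u ((x : Space n) + t • v) *
          (‖(x : Space n) + t • v‖⁻¹ * ⟪(x : Space n) + t • v, v⟫) := by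
    have hc : Tendsto (fun t : ℝ => (x : Space n) + t • v) (𝓝 0) (𝓝 x) := by
      have : Continuous fun t : ℝ => (x : Space n) + t • v := by fun_prop
      simpa using this.tendsto 0
    filter_upwards [hc.eventually (isOpen_ne.mem_nhds hx)] with t ht
    exact fderiv_homExt_one_apply hu ht v
  have E1' := E1.congr_of_eventuallyEq hev.symm
  have := E1'.unique T
  simp only [zero_smul, add_zero, map_zero, hx1, inv_one, one_mul, one_pow, div_one,
    homExt_coe, Pi.inv_apply, Pi.mul_apply] at this
  rw [this]
  ring

theorem fderiv_homExt_one_smul (u : Sph n → ℝ) {t : ℝ} (ht : 0 < t) (y : Space n) :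
    fderiv ℝ (homExt 1 u) (t • y) = fderiv ℝ (homExt 1 u) y := by
  have h1 := fderiv_comp_smul (𝕜 := ℝ) (f := homExt 1 u) (x := y) t
  have h2 : (fun y => homExt 1 u (t • y)) = t • homExt 1 u := by
    ext y; exact homExt_one_smul u ht y
  rw [h2, fderiv_const_smul_field] at h1
  exact (smul_right_injective _ ht.ne' h1).symm

theorem fderiv_fderiv_homExt_one_smul (u : Sph n → ℝ) {t : ℝ} (ht : 0 < t) (y : Space n) :
    fderiv ℝ (fderiv ℝ (homExt 1 u)) (t • y) =
      t⁻¹ • fderiv ℝ (fderiv ℝ (homExt 1 u)) y := by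
  have h1 := fderiv_comp_smul (𝕜 := ℝ) (f := fderiv ℝ (homExt 1 u)) (x := y) t
  have h2 : (fun y => fderiv ℝ (homExt 1 u) (t • y)) = fderiv ℝ (homExt 1 u) := by
    ext1 y; exact fderiv_homExt_one_smul u ht y
  rw [h2] at h1
  rw [h1, smul_smul, inv_mul_cancel₀ ht.ne', one_smul]

theorem exists_bound_homExt_one {u : Sph n → ℝ} (hu : ContMDiff (𝓡 n) 𝓘(ℝ, ℝ) 2 u) :
    ∃ C : ℝ, (∀ y, |homExt 1 u y| ≤ C * ‖y‖) ∧ (∀ y, ‖fderiv ℝ (homExt 1 u) y‖ ≤ C) ∧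
      ∀ y, y ≠ 0 → ‖fderiv ℝ (fderiv ℝ (homExt 1 u)) y‖ ≤ C * ‖y‖⁻¹ := by
  have hK : IsCompact (Metric.sphere (0 : Space n) 1) := isCompact_sphere 0 1
  have hne : ∀ y ∈ Metric.sphere (0 : Space n) 1, y ≠ 0 := fun y hy =>
    ne_zero_of_mem_unit_sphere ⟨y, hy⟩
  have c1 : ∀ y ∈ Metric.sphere (0 : Space n) 1, ContDiffAt ℝ 1 (fderiv ℝ (homExt 1 u)) y :=
    fun y hy => (contDiffAt_homExt_one hu (hne y hy)).fderiv_right (by norm_num)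
  have c2 : ∀ y ∈ Metric.sphere (0 : Space n) 1,
      ContDiffAt ℝ 0 (fderiv ℝ (fderiv ℝ (homExt 1 u))) y :=
    fun y hy => (c1 y hy).fderiv_right (by norm_num)
  obtain ⟨C₀, h₀⟩ := hK.exists_bound_of_continuousOn (f := homExt 1 u)
    fun y hy => (contDiffAt_homExt_one hu (hne y hy)).continuousAt.continuousWithinAt
  obtain ⟨C₁, h₁⟩ := hK.exists_bound_of_continuousOn (f := fderiv ℝ (homExt 1 u))
    fun y hy => (c1 y hy).continuousAt.continuousWithinAt
  obtain ⟨C₂, h₂⟩ := hK.exists_bound_of_continuousOn (f := fderiv ℝ (fderiv ℝ (homExt 1 u)))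
    fun y hy => (c2 y hy).continuousAt.continuousWithinAt
  -- The last term covers the value of `fderiv` at the origin, where homogeneity gives no
  -- information.
  set C := |C₀| + |C₁| + |C₂| + ‖fderiv ℝ (homExt 1 u) 0‖
  have hn := norm_nonneg (fderiv ℝ (homExt 1 u) 0)
  have a₀ := le_abs_self C₀
  have a₁ := le_abs_self C₁
  have a₂ := le_abs_self C₂
  have b₀ := abs_nonneg C₀
  have b₁ := abs_nonneg C₁
  have b₂ := abs_nonneg C₂
  have hsm : ∀ y : Space n, y ≠ 0 → y = ‖y‖ • (‖y‖⁻¹ • y) := fun y hy => by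
    rw [smul_smul, mul_inv_cancel₀ (norm_ne_zero_iff.2 hy), one_smul]
  refine ⟨C, fun y => ?_, fun y => ?_, fun y hy => ?_⟩
  · by_cases hy : y = 0
    · simp [hy, homExt]
    · have h := h₀ _ (normalize_mem hy)
      rw [hsm y hy, homExt_one_smul u (norm_pos_iff.2 hy), ← hsm y hy, abs_mul, abs_norm, mul_comm]
      rw [Real.norm_eq_abs] at h
      gcongr
      linarith
  · by_cases hy : y = 0
    · rw [hy]; linarith
    · have h := h₁ _ (normalize_mem hy)
      rw [hsm y hy, fderiv_homExt_one_smul u (norm_pos_iff.2 hy)]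
      linarith
  · have h := h₂ _ (normalize_mem hy)
    nth_rewrite 1 [hsm y hy]
    rw [fderiv_fderiv_homExt_one_smul u (norm_pos_iff.2 hy), norm_smul_clm, abs_inv,
      abs_norm, mul_comm]
    gcongr
    linarith

theorem continuous_homExt_one {u : Sph n → ℝ} (hu : ContMDiff (𝓡 n) 𝓘(ℝ, ℝ) 2 u) :
    Continuous (homExt 1 u) := by
  obtain ⟨C, h₀, -⟩ := exists_bound_homExt_one hu
  rw [continuous_iff_continuousAt]
  intro y
  by_cases hy : y = 0
  · subst hy
    have h00 : homExt 1 u 0 = 0 := by simp [homExt]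
    rw [ContinuousAt, h00]
    refine squeeze_zero_norm (a := fun y => C * ‖y‖) h₀ ?_
    have : Continuous fun y : Space n => C * ‖y‖ := by fun_prop
    simpa using this.tendsto 0
  · exact (contDiffAt_homExt_one hu hy).continuousAt

theorem covHessian_eq (u : Sph n → ℝ) (x : Sph n) (ξ η : Space n) :
    covHessian u x ξ η = fderiv ℝ (fderiv ℝ (homExt 0 u)) (x : Space n) ξ η := by
  simp [covHessian, iteratedFDeriv_two_apply]

theorem laplaceBeltrami_eq {ι : Type*} [Fintype ι] (b : OrthonormalBasis ι ℝ (Space n))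
    (u : Sph n → ℝ) (x : Sph n) :
    laplaceBeltrami u x = ∑ i, fderiv ℝ (fderiv ℝ (homExt 0 u)) (x : Space n) (b i) (b i) := by
  simp [laplaceBeltrami, InnerProductSpace.laplacian_eq_iteratedFDeriv_orthonormalBasis _ b,
    iteratedFDeriv_two_apply]

/-- `D²` of the one-homogeneous extension is `∇²u + u I` on the tangent space. -/
theorem fderiv_fderiv_homExt_one_tangent {u : Sph n → ℝ} (hu : ContMDiff (𝓡 n) 𝓘(ℝ, ℝ) 2 u)
    (x : Sph n) {ξ : Space n} (hξ : ⟪(x : Space n), ξ⟫ = 0) :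
    fderiv ℝ (fderiv ℝ (homExt 1 u)) (x : Space n) ξ ξ = covHessian u x ξ ξ + u x * ⟪ξ, ξ⟫ := by
  rw [fderiv_fderiv_homExt_one_apply hu, hξ, covHessian_eq]
  ring

/-- By homogeneity of degree `-1` it suffices to take the trace on the sphere, where it is `Δ u +
((n + 1) - 1) u`. -/
theorem IsSolution.sum_fderiv_fderiv_homExt_one {f u : Sph n → ℝ} (hu : IsSolution f u)
    {ι : Type*} [Fintype ι] (b : OrthonormalBasis ι ℝ (Space n)) {y : Space n} (hy : y ≠ 0) :
    ∑ i, fderiv ℝ (fderiv ℝ (homExt 1 u)) y (b i) (b i) =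
      ‖y‖⁻¹ * f ⟨‖y‖⁻¹ • y, normalize_mem hy⟩ := by
  have hy' := norm_pos_iff.2 hy
  set x : Sph n := ⟨‖y‖⁻¹ • y, normalize_mem hy⟩
  have e : y = ‖y‖ • (x : Space n) := by
    simp only [x]; rw [smul_smul, mul_inv_cancel₀ hy'.ne', one_smul]
  have h : fderiv ℝ (fderiv ℝ (homExt 1 u)) y =
      ‖y‖⁻¹ • fderiv ℝ (fderiv ℝ (homExt 1 u)) (x : Space n) := by
    conv_lhs => rw [e]
    exact fderiv_fderiv_homExt_one_smul u hy' _
  rw [h]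
  simp only [smul_apply, smul_eq_mul, ← Finset.mul_sum]
  congr 1
  simp only [fderiv_fderiv_homExt_one_apply hu.contMDiff]
  rw [Finset.sum_add_distrib, Finset.sum_add_distrib, ← Finset.mul_sum, ← Finset.mul_sum,
    ← laplaceBeltrami_eq b u x, Finset.sum_sub_distrib, ← hu.equation x]
  have e1 : ∑ i, ⟪(x : Space n), b i⟫ ^ 2 = 1 := by
    have := b.sum_sq_norm_inner_left (x : Space n)
    simpa using this
  have e2 : ∑ i, ⟪b i, b i⟫ = (n : ℝ) + 1 := by
    have : Fintype.card ι = n + 1 := by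
      rw [← Module.finrank_eq_card_basis b.toBasis]; simp
    simp [this]
  -- The sum is the radial derivative of an extension that is constant along rays.
  have e3 : ∑ i, ⟪(x : Space n), b i⟫ * fderiv ℝ (homExt 0 u) (x : Space n) (b i) = 0 := by
    have h1 := congrArg (fderiv ℝ (homExt 0 u) (x : Space n)) (b.sum_repr' (x : Space n))
    rw [map_sum, fderiv_homExt_zero_self hu.contMDiff (coe_sph_ne_zero x)] at h1
    rw [← h1]
    refine Finset.sum_congr rfl fun i _ => ?_
    rw [map_smul, smul_eq_mul, real_inner_comm]
  rw [e1, e2, e3]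
  ring

theorem homExt_sub_const_eventuallyEq (u : Sph n → ℝ) (c : ℝ) {y : Space n} (hy : y ≠ 0) :
    homExt 0 (fun x => u x - c) =ᶠ[𝓝 y] fun z => homExt 0 u z - c := by
  filter_upwards [isOpen_ne.mem_nhds hy] with z hz
  rw [homExt_of_ne 0 _ hz, homExt_of_ne 0 _ hz]
  simp

theorem covHessian_sub_const (u : Sph n → ℝ) (c : ℝ) (x : Sph n) (ξ η : Space n) :
    covHessian (fun x => u x - c) x ξ η = covHessian u x ξ η := by
  rw [covHessian_eq, covHessian_eq,
    (homExt_sub_const_eventuallyEq u c (coe_sph_ne_zero x)).fderiv.fderiv_eq]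
  congr 3
  ext1 z
  exact fderiv_sub_const c

/-- This allows the right-hand side to be normalized to vanish at a chosen point, which tames the
singularity of the kernel there. -/
theorem IsSolution.sub_const {f u : Sph n → ℝ} (hu : IsSolution f u) (hn : n ≠ 0) (c : ℝ) :
    IsSolution (fun x => f x - c) (fun x => u x - c / n) := by
  refine ⟨hu.contMDiff.sub contMDiff_const, fun x => ?_⟩
  have h := hu.equation x
  have hn' : (n : ℝ) ≠ 0 := by exact_mod_cast hn
  have b := stdOrthonormalBasis ℝ (Space n)
  have e : laplaceBeltrami (fun x => u x - c / n) x = laplaceBeltrami u x := by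
    rw [laplaceBeltrami_eq b, laplaceBeltrami_eq b]
    refine Finset.sum_congr rfl fun i _ => ?_
    rw [← covHessian_eq, ← covHessian_eq, covHessian_sub_const]
  rw [e]
  field_simp
  linarith

/-- The pointwise bound for `∇²u + u I` by the Newton potential of the right-hand side. -/
theorem IsSolution.abs_hessian_mul_omega_le (hn : 1 ≤ n) {f u : Sph n → ℝ} (hu : IsSolution f u)
    (x : Sph n) {ξ : Space n} (hξ : ‖ξ‖ = 1) (hxξ : ⟪(x : Space n), ξ⟫ = 0) {K : Space n → ℝ}
    (iK : Integrable K)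
    (hK : ∀ y (hy : y ≠ 0), |‖y‖⁻¹ * f ⟨‖y‖⁻¹ • y, normalize_mem hy⟩| *
      (‖y - x‖ ^ (n + 1))⁻¹ ≤ K y) :
    |covHessian u x ξ ξ + u x| * omega n ≤ n * ∫ y, K y := by
  obtain ⟨C, h₀, h₁, h₂⟩ := exists_bound_homExt_one hu.contMDiff
  let b := stdOrthonormalBasis ℝ (Space n)
  have hfr : Module.finrank ℝ (Space n) = n + 1 := by simp
  have hb : ∀ i, ‖b i‖ = 1 := fun i => b.orthonormal.1 i
  have hC : 0 ≤ C := (norm_nonneg _).trans (h₁ 0)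
  have key := abs_second_deriv_mul_le (by omega) b hξ (C := C) (U := homExt 1 u)
    (U₁ := fun i y => fderiv ℝ (homExt 1 u) y (b i))
    (U₂ := fun i y => fderiv ℝ (fderiv ℝ (homExt 1 u)) y (b i) (b i))
    (continuous_homExt_one hu.contMDiff).measurable (fun i => measurable_fderiv_apply_const ℝ _ _)
    (fun i => (measurable_fderiv_apply_const ℝ (fderiv ℝ (homExt 1 u))
      (b i)).apply_continuousLinearMap _)
    h₀
    (fun i y => by
      have := (fderiv ℝ (homExt 1 u) y).le_opNorm (b i)
      rw [hb, mul_one] at this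
      exact this.trans (h₁ y))
    (fun i y hy => by
      have := (fderiv ℝ (fderiv ℝ (homExt 1 u)) y).le_opNorm₂ (b i) (b i)
      rw [hb, mul_one, mul_one] at this
      exact this.trans (h₂ y hy))
    (fun i y hy => (((contDiffAt_homExt_one hu.contMDiff hy).differentiableAt
      (by norm_num)).hasFDerivAt).hasLineDerivAt (b i))
    (fun i y hy => by
      have := HasFDerivAt.hasDerivAt_line (differentiableAt_fderiv_of_contDiffAt_two
        (contDiffAt_homExt_one hu.contMDiff hy)).hasFDerivAt (b i)
      have h := this.clm_apply (hasDerivAt_const (0 : ℝ) (b i))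
      simpa [HasLineDerivAt] using h)
    (isLittleO_taylor_two (contDiffAt_homExt_one hu.contMDiff (coe_sph_ne_zero x))) iK
    (fun y hy => by
      rw [hu.sum_fderiv_fderiv_homExt_one b hy, hfr]
      exact hK y hy)
  rw [fderiv_fderiv_homExt_one_tangent hu.contMDiff x hxξ, real_inner_self_eq_norm_sq, hξ,
    hfr] at key
  simpa [omega] using key

end HomogeneousExtension

/-! ### From the Hessian on the sphere to convexity of the extension. -/

section Convexity

variable {n : ℕ}

theorem fderiv_homExt_one_self {u : Sph n → ℝ} (hu : ContMDiff (𝓡 n) 𝓘(ℝ, ℝ) 2 u)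
    {y : Space n} (hy : y ≠ 0) : fderiv ℝ (homExt 1 u) y y = homExt 1 u y := by
  have hy' : ‖y‖ ≠ 0 := norm_ne_zero_iff.2 hy
  rw [fderiv_homExt_one_apply hu hy, fderiv_homExt_zero_self hu hy, homExt_one_eq,
    real_inner_self_eq_norm_sq]
  field_simp
  ring

theorem fderiv_fderiv_homExt_one_self {u : Sph n → ℝ} (hu : ContMDiff (𝓡 n) 𝓘(ℝ, ℝ) 2 u)
    {y : Space n} (hy : y ≠ 0) : fderiv ℝ (fderiv ℝ (homExt 1 u)) y y = 0 := by
  have h := HasFDerivAt.hasDerivAt_line (differentiableAt_fderiv_of_contDiffAt_two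
    (contDiffAt_homExt_one hu hy)).hasFDerivAt y
  refine h.unique ?_
  refine (hasDerivAt_const (0 : ℝ) (fderiv ℝ (homExt 1 u) y)).congr_of_eventuallyEq ?_
  filter_upwards [lt_mem_nhds (show (-1 : ℝ) < 0 by norm_num)] with t ht
  have : y + t • y = (1 + t) • y := by rw [add_smul, one_smul]
  rw [this, fderiv_homExt_one_smul u (by linarith)]

/-- The radial direction lies in the kernel of the symmetric form `D²U`, so only the tangential part
of `v` contributes. -/
theorem HessianNonneg.fderiv_fderiv_nonneg {u : Sph n → ℝ} (hu : ContMDiff (𝓡 n) 𝓘(ℝ, ℝ) 2 u)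
    (h : HessianNonneg u) {y : Space n} (hy : y ≠ 0) (v : Space n) :
    0 ≤ fderiv ℝ (fderiv ℝ (homExt 1 u)) y v v := by
  have hy' := norm_pos_iff.2 hy
  obtain ⟨x, hx⟩ : ∃ x : Sph n, y = ‖y‖ • (x : Space n) :=
    ⟨⟨‖y‖⁻¹ • y, normalize_mem hy⟩, by
      simp only; rw [smul_smul, mul_inv_cancel₀ hy'.ne', one_smul]⟩
  have hx0 := coe_sph_ne_zero x
  rw [hx, fderiv_fderiv_homExt_one_smul u hy']
  simp only [smul_apply, smul_eq_mul]
  refine mul_nonneg (by positivity) ?_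
  set B := fderiv ℝ (fderiv ℝ (homExt 1 u)) (x : Space n) with hB
  have hB0 : B x = 0 := fderiv_fderiv_homExt_one_self hu hx0
  have hsymm : B v x = B x v := (contDiffAt_homExt_one hu hx0).isSymmSndFDerivAt (by simp) v x
  set ξ := v - ⟪(x : Space n), v⟫ • (x : Space n) with hξ
  have hperp : ⟪(x : Space n), ξ⟫ = 0 := by
    rw [hξ, inner_sub_right, real_inner_smul_right, real_inner_self_eq_norm_sq]
    simp
  have e : B v v = B ξ ξ := by
    rw [hξ]
    simp [hB0, hsymm]
  rw [e, fderiv_fderiv_homExt_one_tangent hu x hperp]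
  exact h x ξ hperp

/-- Along a segment from `y` to `w` that misses the origin, `U` has nonnegative second derivative,
hence lies above its tangent at `y`; by Euler's relation `DU(y) y = U(y)` that tangent is linear. -/
theorem HessianNonneg.fderiv_homExt_one_le (hn : 1 ≤ n) {u : Sph n → ℝ}
    (hu : ContMDiff (𝓡 n) 𝓘(ℝ, ℝ) 2 u) (h : HessianNonneg u) {y : Space n} (hy : y ≠ 0)
    (w : Space n) : fderiv ℝ (homExt 1 u) y w ≤ homExt 1 u w := by
  have hgen : ∀ w : Space n, w - 0 ∉ Submodule.span ℝ {y} →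
      fderiv ℝ (homExt 1 u) y w ≤ homExt 1 u w := by
    intro w hw
    rw [sub_zero] at hw
    have hne : ∀ t : ℝ, y + t • (w - y) ≠ 0 := by
      intro t ht
      by_cases h0 : t = 0
      · simp [h0, hy] at ht
      · refine hw (Submodule.mem_span_singleton.2 ⟨t⁻¹ * (t - 1), ?_⟩)
        have h1 : t • w = (t - 1) • y := by
          rw [← sub_eq_zero, ← ht]; module
        rw [mul_smul, ← h1, smul_smul, inv_mul_cancel₀ h0, one_smul]
    have hshift : ∀ (F : Type) [NormedAddCommGroup F] [NormedSpace ℝ F] (g : ℝ → F) (g' : F)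
        (t : ℝ), HasDerivAt (fun s => g (t + s)) g' 0 → HasDerivAt g g' t := by
      intro F _ _ g g' t hg
      have : HasDerivAt (fun s => g (t + s)) g' (t - t) := by rwa [sub_self]
      have := this.comp_sub_const t t
      simpa using this
    have hd1 : ∀ t : ℝ, HasDerivAt (fun t : ℝ => homExt 1 u (y + t • (w - y)))
        (fderiv ℝ (homExt 1 u) (y + t • (w - y)) (w - y)) t := fun t => by
      refine hshift ℝ _ _ t ?_
      have := HasFDerivAt.hasDerivAt_line ((contDiffAt_homExt_one hu (hne t)).differentiableAt
        (by norm_num)).hasFDerivAt (w - y)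
      simpa only [add_smul, add_assoc] using this
    have hd2 : ∀ t : ℝ, HasDerivAt
        (fun t : ℝ => fderiv ℝ (homExt 1 u) (y + t • (w - y)) (w - y))
        (fderiv ℝ (fderiv ℝ (homExt 1 u)) (y + t • (w - y)) (w - y) (w - y)) t := fun t => by
      refine hshift ℝ _ _ t ?_
      have := HasFDerivAt.hasDerivAt_line (differentiableAt_fderiv_of_contDiffAt_two
        (contDiffAt_homExt_one hu (hne t))).hasFDerivAt (w - y)
      have := this.clm_apply (hasDerivAt_const (0 : ℝ) (w - y))
      simpa only [add_smul, add_assoc, map_zero, add_zero] using this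
    obtain ⟨c, hc, hc'⟩ := exists_hasDerivAt_eq_slope _ _ (zero_lt_one (α := ℝ))
      (fun t _ => (hd1 t).continuousAt.continuousWithinAt) (fun t _ => hd1 t)
    obtain ⟨d, hd, hd'⟩ := exists_hasDerivAt_eq_slope _ _ hc.1
      (fun t _ => (hd2 t).continuousAt.continuousWithinAt) (fun t _ => hd2 t)
    have hnn := h.fderiv_fderiv_nonneg hu (hne d) (w - y)
    rw [hd', le_div_iff₀ (by linarith [hc.1])] at hnn
    simp only [zero_smul, add_zero, one_smul, add_sub_cancel, sub_zero, div_one, zero_mul]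
      at hnn hc'
    rw [hc', map_sub, fderiv_homExt_one_self hu hy] at hnn
    linarith
  -- The excluded `w`, for which the segment might meet the origin, form a null line, so continuity
  -- of both sides extends the inequality to them.
  have hdense : Dense {w : Space n | w - 0 ∉ Submodule.span ℝ {y}} :=
    Measure.dense_of_ae (ae_sub_notMem_span_singleton (by simp; omega) 0 y)
  have hclosed : IsClosed {w : Space n | fderiv ℝ (homExt 1 u) y w ≤ homExt 1 u w} :=
    isClosed_le (fderiv ℝ (homExt 1 u) y).continuous (continuous_homExt_one hu)
  exact closure_minimal hgen hclosed (hdense w)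

theorem HessianNonneg.convexOn_homExt_one (hn : 1 ≤ n) {u : Sph n → ℝ}
    (hu : ContMDiff (𝓡 n) 𝓘(ℝ, ℝ) 2 u) (h : HessianNonneg u) :
    ConvexOn ℝ univ (homExt 1 u) := by
  refine ⟨convex_univ, fun x _ y _ a b ha hb hab => ?_⟩
  have hsup : ∀ z, z ≠ 0 → fderiv ℝ (homExt 1 u) z (a • x + b • y) ≤
      a • homExt 1 u x + b • homExt 1 u y := fun z hz => by
    rw [map_add, map_smul, map_smul, smul_eq_mul, smul_eq_mul, smul_eq_mul, smul_eq_mul]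
    exact add_le_add (mul_le_mul_of_nonneg_left (h.fderiv_homExt_one_le hn hu hz x) ha)
      (mul_le_mul_of_nonneg_left (h.fderiv_homExt_one_le hn hu hz y) hb)
  by_cases hz : a • x + b • y = 0
  -- `U` need not be differentiable at the origin; any nonzero base point works, since its tangent
  -- functional vanishes at 0.
  · have hN : northPole n ≠ 0 := by simp [northPole]
    have := hsup _ hN
    rw [hz, map_zero] at this
    rw [hz]
    simpa [homExt] using this
  · have := hsup _ hz
    rwa [fderiv_homExt_one_self hu hz] at this

end Convexity

/-! ### Rotation invariance and the pinching argument. -/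

section Main

variable {n : ℕ}

/-- The integrand of `gammaConst`, with the north pole replaced by `x`. -/
def gammaIntegrand (α : ℝ) (x y : Space n) : ℝ :=
  (‖y - x‖ ^ (n + 1))⁻¹ * ‖y‖⁻¹ * InnerProductGeometry.angle (‖y‖⁻¹ • y) x ^ α

theorem gammaIntegrand_nonneg (α : ℝ) (x y : Space n) : 0 ≤ gammaIntegrand α x y := by
  unfold gammaIntegrand
  have := Real.rpow_nonneg (InnerProductGeometry.angle_nonneg (‖y‖⁻¹ • y) x) α
  positivity

theorem gammaIntegrand_map (α : ℝ) (T : Space n ≃ₗᵢ[ℝ] Space n) (x y : Space n) :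
    gammaIntegrand α (T x) (T y) = gammaIntegrand α x y := by
  unfold gammaIntegrand
  rw [← map_sub, T.norm_map, T.norm_map, ← map_smul]
  congr 2
  exact T.toLinearIsometry.angle_map _ _

/-- Two vectors of equal length are exchanged by the reflection in the hyperplane orthogonal to
their difference. -/
theorem exists_isometry_northPole (x : Sph n) :
    ∃ T : Space n ≃ₗᵢ[ℝ] Space n, T (northPole n) = x :=
  ⟨_, Submodule.reflection_sub (by simp [northPole])⟩

theorem integral_gammaIntegrand (α : ℝ) (x : Sph n) :
    ∫ y, gammaIntegrand α (x : Space n) y = ∫ y, gammaIntegrand α (northPole n) y := by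
  obtain ⟨T, hT⟩ := exists_isometry_northPole x
  have := T.measurePreserving.integral_comp T.toMeasurableEquiv.measurableEmbedding
    (gammaIntegrand α (x : Space n))
  rw [← this, ← hT]
  simp only [gammaIntegrand_map]

theorem omega_pos (n : ℕ) : 0 < omega n := by
  unfold omega
  rw [Measure.toSphere_real_apply_univ]
  have h1 : 0 < (volume : Measure (Space n)).real (Metric.ball 0 1) :=
    
    ENNReal.toReal_pos (Metric.measure_ball_pos _ _ one_pos).ne' measure_ball_lt_top.ne
  have h2 : 0 < Module.finrank ℝ (Space n) := by simp
  positivity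

theorem abs_sub_le_holderSeminorm {α : ℝ} {f : Sph n → ℝ} (hf : IsHolder α f) (x z : Sph n) :
    |f x - f z| ≤ holderSeminorm α f * sphDist x z ^ α := by
  obtain ⟨C, hC⟩ := hf
  have hd : ∀ x z : Sph n, 0 ≤ sphDist x z ^ α := fun x z =>
    Real.rpow_nonneg (InnerProductGeometry.angle_nonneg _ _) α
  have hbdd : BddAbove (range fun p : Sph n × Sph n => |f p.1 - f p.2| / sphDist p.1 p.2 ^ α) := by
    refine ⟨|C|, ?_⟩
    rintro _ ⟨p, rfl⟩
    refine div_le_of_le_mul₀ (hd _ _) (abs_nonneg C) ((hC p.1 p.2).trans ?_)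
    exact mul_le_mul_of_nonneg_right (le_abs_self C) (hd _ _)
  -- When the denominator vanishes the quotient in the supremum is 0 and carries no information, so
  -- the Hölder bound itself is used.
  rcases (hd x z).eq_or_lt with h0 | h0
  · have := hC x z
    rw [← h0, mul_zero] at this ⊢
    exact this
  · exact (div_le_iff₀ h0).1 (le_ciSup hbdd (x, z))

theorem holderSeminorm_nonneg (α : ℝ) (f : Sph n → ℝ) : 0 ≤ holderSeminorm α f :=
  Real.iSup_nonneg fun _ => div_nonneg (abs_nonneg _)
    (Real.rpow_nonneg (InnerProductGeometry.angle_nonneg _ _) α)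

theorem IsSolution.hessianNonneg (hn : 1 ≤ n) {α : ℝ} {f u : Sph n → ℝ} (hf : IsHolder α f)
    (hpos : ∀ x, 0 < f x) (hγ : holderSeminorm α f ≤ gammaConst n α * ⨅ x, f x)
    (hu : IsSolution f u) : HessianNonneg u := by
  have hn0 : (0 : ℝ) < n := by exact_mod_cast hn
  set S := holderSeminorm α f with hSdef
  have hS : 0 ≤ S := holderSeminorm_nonneg α f
  set I := ∫ y, gammaIntegrand α (northPole n) y with hI
  have hI0 : 0 ≤ I := integral_nonneg fun y => gammaIntegrand_nonneg α _ y
  have hγI : gammaConst n α = omega n / (n * (n + 1)) * I⁻¹ := rfl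
  have hω := omega_pos n
  have hinf : ∀ x, ⨅ x, f x ≤ f x := fun x => ciInf_le ⟨0, by
    rintro _ ⟨z, rfl⟩; exact (hpos z).le⟩ x
  have hSI : ∀ x, n * (S * I) ≤ omega n * (f x / (n + 1)) := by
    intro x
    rcases hI0.eq_or_lt with h0 | h0
    · rw [← h0]
      have := hpos x
      simp only [mul_zero]
      positivity
    · rw [hγI] at hγ
      have h1 : S ≤ omega n / (n * (n + 1)) * I⁻¹ * f x :=
        hγ.trans (by gcongr; exact hinf x)
      calc n * (S * I) ≤ n * (omega n / (n * (n + 1)) * I⁻¹ * f x * I) := by gcongr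
        _ = _ := by field_simp
  have hint : ∀ x : Sph n, Integrable fun y => S * gammaIntegrand α (x : Space n) y := by
    intro x
    rcases hS.eq_or_lt with h0 | h0
    · simp [← h0]
    · refine Integrable.const_mul ?_ _
      -- A divergent integral has the value 0, which would force `gammaConst n α = 0` and hence `S ≤
      -- 0`.
      by_contra hni
      have h1 := integral_undef hni
      rw [integral_gammaIntegrand, ← hI] at h1
      rw [hγI, h1, inv_zero, mul_zero, zero_mul] at hγ
      linarith
  have hunit : ∀ (x : Sph n) (η : Space n), ‖η‖ = 1 → ⟪(x : Space n), η⟫ = 0 →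
      0 ≤ covHessian u x η η + u x := by
    intro x η hη hxη
    -- The normalization `f - f x` is chosen anew at each point `x`, so that the Hölder bound
    -- dominates the integrand by `S * gammaIntegrand α x`.
    have h := (hu.sub_const (by omega) (f x)).abs_hessian_mul_omega_le hn x hη hxη (hint x)
      (fun y hy => by
        have h1 := abs_sub_le_holderSeminorm hf ⟨‖y‖⁻¹ • y, normalize_mem hy⟩ x
        rw [abs_mul, abs_of_nonneg (by positivity : 0 ≤ ‖y‖⁻¹)]
        calc _ ≤ ‖y‖⁻¹ * (S * sphDist ⟨‖y‖⁻¹ • y, normalize_mem hy⟩ x ^ α) *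
              (‖y - (x : Space n)‖ ^ (n + 1))⁻¹ := by gcongr
          _ = _ := by
            simp only [gammaIntegrand, sphDist]
            ring)
    rw [covHessian_sub_const, integral_const_mul, integral_gammaIntegrand, ← hI] at h
    have h2 := h.trans (hSI x)
    rw [mul_comm] at h2
    -- After division by `omega n`, the quantity `∇²u(η,η) + u` differs from `f x / n` by at most `f
    -- x / (n + 1)`.
    have h3 := (abs_le.1 (le_of_mul_le_mul_left h2 hω)).1
    have h4 : f x / (n + 1) ≤ f x / n := by
      have := (hpos x).le
      gcongr
      linarith
    linarith
  intro x ξ hξ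
  by_cases h0 : ξ = 0
  · simp [h0, covHessian_eq]
  · have hξ0 : ‖ξ‖ ≠ 0 := norm_ne_zero_iff.2 h0
    set η := ‖ξ‖⁻¹ • ξ
    have hη : ‖η‖ = 1 := by
      simp only [η]; rw [norm_smul, norm_inv, norm_norm, inv_mul_cancel₀ hξ0]
    have e : ξ = ‖ξ‖ • η := by
      simp only [η]; rw [smul_smul, mul_inv_cancel₀ hξ0, one_smul]
    have h1 := hunit x η hη (by
      simp only [η]; rw [real_inner_smul_right, hξ, mul_zero])
    have h2 : covHessian u x ξ ξ + u x * ⟪ξ, ξ⟫ = ‖ξ‖ ^ 2 * (covHessian u x η η + u x) := by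
      have h3 : covHessian u x ξ ξ = ‖ξ‖ ^ 2 * covHessian u x η η := by
        rw [covHessian_eq, covHessian_eq]
        conv_lhs => rw [e]
        simp only [map_smul, smul_apply, smul_eq_mul]
        ring
      rw [h3, real_inner_self_eq_norm_sq]
      ring
    rw [h2]
    positivity

end Main

end ChristoffelProblem

end

theorem theorem3p2 (n : ℕ) (hn : 2 ≤ n) (α : ℝ) (hα0 : 0 < α) (hα1 : α < 1)
    (f : ChristoffelProblem.Sph n → ℝ)
    (hf : ChristoffelProblem.IsHolder α f)
    (hpos : ∀ x, 0 < f x)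
    (hγ : ChristoffelProblem.holderSeminorm α f ≤
      ChristoffelProblem.gammaConst n α * ⨅ x, f x)
    (u : ChristoffelProblem.Sph n → ℝ)
    (hu : ChristoffelProblem.IsSolution f u) :
    ChristoffelProblem.HessianNonneg u ∧
      ConvexOn ℝ Set.univ (ChristoffelProblem.homExt 1 u) := by
  have h := ChristoffelProblem.IsSolution.hessianNonneg (by omega) hf hpos hγ hu
  exact ⟨h, h.convexOn_homExt_one (by omega) hu.contMDiff⟩
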